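/- A finite digraph is a pair $G=(V,E)$ with $V$ a nonempty finite set and $E\subseteq V^2$ (loops are allowed). Let $\mathcal{D}$ be the set of isomorphism types of finite digraphs. For $G,G'\in\mathcal{D}$ write $G\le G'$ if there is an injective map $\varphi:V(G)\to V(G')$ such that $(u,v)\in E(G)$ implies $(\varphi(u),\varphi(v))\in E(G')$ (embeddability), and write $G\sqsubseteq G'$ if $G$ is isomorphic to the digraph induced by $G'$ on some subset of $V(G')$ (substructure). For a binary relation $\rho$ on $\mathcal{D}$ and $C\subseteq\mathcal{D}$, an $n$-ary relation $R\subseteq\mathcal{D}^n$ is definable in $(\mathcal{D};\rho,C)$ if there is a first-order formula $\Psi(x_1,\dots,x_n)$, in the language with equality, one binary relation symbol interpreted as $\rho$, and a constant symbol for each element of $C$, such that for all $a_1,\dots,a_n\in\mathcal{D}$, $\Psi(a_1,\dots,a_n)$ holds if and only if $(a_1,\dots,a_n)\in R$. **Theorem.** There is a finite set $\{C_1,\dots,C_k\}$ of finite digraphs such that the binary relation $\{(G,G')\in\mathcal{D}^2 : G\le G'\}$ is definable in $(\mathcal{D};\sqsubseteq,C_1,\dots,C_k)$; in fact the (finite)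 set of all isomorphism types of digraphs with at most $4$ vertices has this property. Consequently, for this same set and every $n$, every $n$-ary relation on $\mathcal{D}$ that is definable in $(\mathcal{D};\le)$ (without constants) is definable in $(\mathcal{D};\sqsubseteq,C_1,\dots,C_k)$. -/

import Mathlib

open FirstOrder

/-- A finite digraph: a nonempty finite vertex set with an arbitrary binary edge relation
(loops and pairs of opposite edges are allowed). -/
structure FinDigraph where
  V : Type
  [finite : Finite V]
  [nonempty : Nonempty V]
  graph : Digraph V

namespace FinDigraph

/-- Isomorphism of digraphs. -/
def Iso (G H : FinDigraph) : Prop :=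
  Nonempty (G.graph.Adj ≃r H.graph.Adj)

/-- `G` is embeddable into `H`: there is an injective homomorphism from `G` to `H`. -/
def Embeds (G H : FinDigraph) : Prop :=
  ∃ f : G.V → H.V, Function.Injective f ∧ ∀ v w, G.graph.Adj v w → H.graph.Adj (f v) (f w)

/-- `G` is a substructure of `H`: it is isomorphic to the digraph that `H` induces on some
set of vertices. -/
def IsSub (G H : FinDigraph) : Prop :=
  ∃ S : Set H.V, Nonempty (G.graph.Adj ≃r fun v w : S => H.graph.Adj v w)

theorem isSub_iff (G H : FinDigraph) :
    G.IsSub H ↔ Nonempty (G.graph.Adj ↪r H.graph.Adj) := by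
  constructor
  · rintro ⟨S, ⟨e⟩⟩
    exact ⟨⟨⟨fun v => (e v : H.V), fun a b h => e.injective (Subtype.ext h)⟩,
      fun {a b} => e.map_rel_iff⟩⟩
  · rintro ⟨f⟩
    exact ⟨Set.range f, ⟨⟨Equiv.ofInjective f f.injective, fun {a b} => f.map_rel_iff⟩⟩⟩

instance setoid : Setoid FinDigraph where
  r := Iso
  iseqv :=
    { refl := fun _ => ⟨RelIso.refl _⟩
      symm := fun ⟨e⟩ => ⟨e.symm⟩
      trans := fun ⟨e⟩ ⟨f⟩ => ⟨e.trans f⟩ }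

theorem Embeds.congr {G G' H H' : FinDigraph} (hG : G.Iso G') (hH : H.Iso H')
    (h : G.Embeds H) : G'.Embeds H' := by
  obtain ⟨e⟩ := hG
  obtain ⟨e'⟩ := hH
  obtain ⟨f, hf, hadj⟩ := h
  exact ⟨fun v => e' (f (e.symm v)), e'.injective.comp (hf.comp e.symm.injective),
    fun v w hvw => e'.map_rel_iff.2 (hadj _ _ (e.symm.map_rel_iff.2 hvw))⟩

theorem IsSub.congr {G G' H H' : FinDigraph} (hG : G.Iso G') (hH : H.Iso H')
    (h : G.IsSub H) : G'.IsSub H' := by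
  obtain ⟨e⟩ := hG
  obtain ⟨e'⟩ := hH
  rw [isSub_iff] at h ⊢
  obtain ⟨f⟩ := h
  exact ⟨(e.symm.toRelEmbedding.trans f).trans e'.toRelEmbedding⟩

end FinDigraph

/-- The set `𝒟` of isomorphism types of finite digraphs. -/
def DigraphType : Type 1 := Quotient FinDigraph.setoid

namespace DigraphType

/-- The number of vertices. -/
noncomputable def order : DigraphType → ℕ :=
  Quotient.lift (fun G => Nat.card G.V) fun _ _ ⟨e⟩ => Nat.card_congr e.toEquiv

/-- The embeddability order `≤` on `𝒟`. -/
def Embeds : DigraphType → DigraphType → Prop :=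
  Quotient.lift₂ FinDigraph.Embeds fun _ _ _ _ hG hH =>
    propext ⟨FinDigraph.Embeds.congr hG hH,
      FinDigraph.Embeds.congr (Setoid.symm hG) (Setoid.symm hH)⟩

/-- The substructure order `⊑` on `𝒟`. -/
def IsSub : DigraphType → DigraphType → Prop :=
  Quotient.lift₂ FinDigraph.IsSub fun _ _ _ _ hG hH =>
    propext ⟨FinDigraph.IsSub.congr hG hH,
      FinDigraph.IsSub.congr (Setoid.symm hG) (Setoid.symm hH)⟩

/-- `𝒟` as a structure for the language with one binary relation symbol, interpreted by `r`. -/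
@[reducible]
def relStructure (r : DigraphType → DigraphType → Prop) :
    Language.order.Structure DigraphType where
  RelMap | .le => fun x => r (x 0) (x 1)

/-- The relation `R` is first-order definable in `(𝒟; r, C)`, where each element of `C` is named
by a constant symbol. -/
def DefinableIn (r : DigraphType → DigraphType → Prop) (C : Set DigraphType) {n : ℕ}
    (R : Set (Fin n → DigraphType)) : Prop :=
  letI := relStructure r
  C.Definable Language.order R

/-- The isomorphism types of digraphs with at most four vertices. -/
def small : Set DigraphType := {G | G.order ≤ 4}

end DigraphType

/-! The order `⊑` only sees isomorphism types, so the difficulty is to speak of single vertices and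
edges of `G` and to match them with those of `H`. The remedy is to enclose `G` in a larger digraph
`Z`, a frame, whose parts can be recognised from `⊑`. Besides `G`, the frame has a full digraph `K`
and an edgeless digraph `E`. `K` and `E` are joined in both directions, every vertex of `G` sends
edges to all of `E` and receives none, and no edge goes from `K` to `G`. Edges from `G` to `K` are
free and serve as labels: the out-neighbourhoods in `K` form a strict chain, so a vertex of `G` is
identified by its out-degree into `K`, its number.

Covers in `⊑` are one-vertex extensions (`covers_iff`), so conditions on frames become conditions on
extensions of `K` or `E` by one or two vertices. Each such condition is expressed by patterns of at
most four vertices, and these are definable with the constants (`DefPred.pattern`). The conditions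
force `K` and `E` to have unique copies in `Z` (`IsFrame.exists_frameOn`). Deleting one copy or the
other gives the largest subdigraphs `A = G ∪ K` and `B = G ∪ E` of two definable kinds, and `G` is
the meet of `A` and `B` (`FrameOn.isMeet`), so the frame determines `G`.

A one-vertex extension of `K` inside `A` is a vertex of `G` with its number and its loop; a
two-vertex extension is a pair of vertices, whose edges are told apart by running from the smaller
to the larger number or back. Numbers in different frames are compared by means of full digraphs
(`CoreOn.sameNumber_iff`). Hence it is definable that matching equal numbers sends `G` into `H` and
preserves edges (`CoreOn.numberLE_iff`). This map is injective, so the formula implies `G ≤ H`;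
conversely, an embedding lets `G` inherit a numbering of `H`, and `frame` realises both frames over
the same `K` and `E`. -/

namespace FinDigraph

/-! ### The substructure preorder and induced subdigraphs -/

theorem IsSub.refl (G : FinDigraph) : G.IsSub G :=
  (isSub_iff G G).2 ⟨RelEmbedding.refl _⟩

theorem IsSub.trans {G H K : FinDigraph} (h : G.IsSub H) (h' : H.IsSub K) : G.IsSub K := by
  rw [isSub_iff] at *
  obtain ⟨f⟩ := h
  obtain ⟨g⟩ := h'
  exact ⟨f.trans g⟩

/-- The subdigraph induced on a nonempty set of vertices. -/
def ind (G : FinDigraph) (S : Set G.V) (hS : S.Nonempty) : FinDigraph :=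
  haveI := G.finite
  haveI := hS.to_subtype
  ⟨S, ⟨fun v w => G.graph.Adj v w⟩⟩

theorem ind_isSub (G : FinDigraph) (S : Set G.V) (hS : S.Nonempty) : (G.ind S hS).IsSub G :=
  ⟨S, ⟨RelIso.refl _⟩⟩

end FinDigraph

/-! ### Finitely many constants and a calculus of definable predicates -/

namespace DigraphType

theorem small_finite : small.Finite := by
  classical
  -- Vertex sets are nonempty, so the index `n < 4` stands for order `n + 1`.
  let g : (Σ n : Fin 4, Digraph (Fin (n + 1))) → DigraphType := fun p =>
    Quotient.mk _ (⟨Fin (p.1 + 1), p.2⟩ : FinDigraph)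
  have : Finite (Σ n : Fin 4, Digraph (Fin (n + 1))) := by
    have : ∀ n : ℕ, Finite (Digraph (Fin n)) := fun n =>
      Finite.of_injective (fun G : Digraph (Fin n) => G.Adj) fun G H h => Digraph.ext h
    infer_instance
  refine (Set.finite_range g).subset ?_
  intro x hx
  induction x using Quotient.inductionOn with
  | h G =>
    have hf := G.finite
    have hn := G.nonempty
    have hc : Nat.card G.V ≤ 4 := hx
    have hpos : 0 < Nat.card G.V := Nat.card_pos
    obtain ⟨e⟩ : Nonempty (G.V ≃ Fin ((⟨Nat.card G.V - 1, by omega⟩ : Fin 4) + 1)) := by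
      refine ⟨(Finite.equivFin G.V).trans (finCongr ?_)⟩
      simp only; omega
    refine ⟨⟨⟨Nat.card G.V - 1, by omega⟩, ⟨fun a b => G.graph.Adj (e.symm a) (e.symm b)⟩⟩, ?_⟩
    refine Quotient.sound ?_
    exact ⟨⟨e.symm, Iff.rfl⟩⟩

/-- `𝒟` with the substructure order, as a first-order structure. -/
@[reducible]
def subStructure : Language.order.Structure DigraphType := relStructure IsSub

end DigraphType

attribute [local instance] DigraphType.subStructure

open DigraphType in
/-- A property of families of finite digraphs is definable if it is isomorphism invariant and
given by a first-order formula over `(𝒟; ⊑)` with constants for the small digraphs. -/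
def DefPred {α : Type} (P : (α → FinDigraph) → Prop) : Prop :=
  ∃ s : Set (α → DigraphType), small.Definable Language.order s ∧
    ∀ v, P v ↔ (fun a => (Quotient.mk _ (v a) : DigraphType)) ∈ s

namespace DefPred

open DigraphType

variable {α : Type} {P Q : (α → FinDigraph) → Prop}

theorem congr (h : DefPred P) (hPQ : ∀ v, Q v ↔ P v) : DefPred Q := by
  obtain ⟨s, hs, hP⟩ := h
  exact ⟨s, hs, fun v => (hPQ v).trans (hP v)⟩

theorem not (h : DefPred P) : DefPred fun v => ¬ P v := by
  obtain ⟨s, hs, hP⟩ := h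
  exact ⟨sᶜ, hs.compl, fun v => not_congr (hP v)⟩

theorem and (h : DefPred P) (h' : DefPred Q) : DefPred fun v => P v ∧ Q v := by
  obtain ⟨s, hs, hP⟩ := h
  obtain ⟨t, ht, hQ⟩ := h'
  exact ⟨s ∩ t, hs.inter ht, fun v => and_congr (hP v) (hQ v)⟩

theorem or (h : DefPred P) (h' : DefPred Q) : DefPred fun v => P v ∨ Q v := by
  obtain ⟨s, hs, hP⟩ := h
  obtain ⟨t, ht, hQ⟩ := h'
  exact ⟨s ∪ t, hs.union ht, fun v => or_congr (hP v) (hQ v)⟩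

theorem imp (h : DefPred P) (h' : DefPred Q) : DefPred fun v => P v → Q v :=
  (h.not.or h').congr fun _ => imp_iff_not_or

theorem iff (h : DefPred P) (h' : DefPred Q) : DefPred fun v => P v ↔ Q v :=
  ((h.imp h').and (h'.imp h)).congr fun _ => iff_def

/-- Quantifying over digraphs or over their types is the same, since every type has a representative
and the truth of the predicate depends only on types. The bound variable is the extra index in
`Unit`. -/
theorem ex {P : (α → FinDigraph) → FinDigraph → Prop}
    (h : DefPred fun v : α ⊕ Unit → FinDigraph => P (fun a => v (.inl a)) (v (.inr ()))) :
    DefPred fun v => ∃ X, P v X := by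
  obtain ⟨s, hs, hP⟩ := h
  refine ⟨_, hs.exists_of_finite, fun v => ⟨?_, ?_⟩⟩
  · rintro ⟨X, hX⟩
    refine ⟨fun _ => Quotient.mk _ X, ?_⟩
    have := (hP (Sum.elim v fun _ => X)).1 hX
    rwa [show (fun a => (Quotient.mk _ (Sum.elim v (fun _ => X) a) : DigraphType)) =
      Sum.elim (fun a => Quotient.mk _ (v a)) fun _ : Unit => Quotient.mk _ X from
      funext (by rintro (a | a) <;> rfl)] at this
  · rintro ⟨u, hu⟩
    obtain ⟨X, hX⟩ := Quotient.exists_rep (u ())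
    refine ⟨X, (hP (Sum.elim v fun _ => X)).2 ?_⟩
    rwa [show (fun a => (Quotient.mk _ (Sum.elim v (fun _ => X) a) : DigraphType)) =
      Sum.elim (fun a => Quotient.mk _ (v a)) u from
      funext (by rintro (a | a); exacts [rfl, hX])]

theorem all {P : (α → FinDigraph) → FinDigraph → Prop}
    (h : DefPred fun v : α ⊕ Unit → FinDigraph => P (fun a => v (.inl a)) (v (.inr ()))) :
    DefPred fun v => ∀ X, P v X :=
  (ex (P := fun v X => ¬ P v X) h.not).not.congr fun v => by simp

theorem isSub (i j : α) : DefPred fun v => (v i).IsSub (v j) := by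
  refine ⟨{v | IsSub (v i) (v j)}, ?_, fun v => Iff.rfl⟩
  refine Set.Definable.mono (A := ∅) ?_ (Set.empty_subset _)
  rw [Set.empty_definable_iff]
  exact ⟨Language.Relations.formula₂ Language.orderRel.le (Language.Term.var i) (Language.Term.var j), by
    ext v
    exact (Language.Formula.realize_rel₂ (L := Language.order) (M := DigraphType)
      (R := Language.orderRel.le) (t₁ := Language.Term.var i) (t₂ := Language.Term.var j)).symm⟩

/-- A finite disjunction of atomic formulas, one for each constant in `S`. -/
theorem exists_small_isSub (S : Set DigraphType) (hS : S ⊆ small) (i : α) :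
    DefPred fun v => ∃ F : FinDigraph, (Quotient.mk _ F : DigraphType) ∈ S ∧ F.IsSub (v i) := by
  have : Finite S := (small_finite.subset hS).to_subtype
  refine ⟨⋃ F : S, {v | IsSub F (v i)}, ?_, fun v => ?_⟩
  · refine Set.definable_iUnion_of_finite fun F => ?_
    refine Set.Definable.mono (A := {(F : DigraphType)}) ?_ (by simpa using hS F.2)
    refine ⟨Language.Relations.formula₂ (Sum.inl Language.orderRel.le)
      (Language.order.con (⟨F, rfl⟩ : ({(F : DigraphType)} : Set _))).term (Language.Term.var i), ?_⟩
    ext v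
    exact (Language.Formula.realize_rel₂ (L := Language.order[[({(F : DigraphType)} : Set _)]])
      (M := DigraphType) (R := Sum.inl Language.orderRel.le)
      (t₁ := (Language.order.con (⟨F, rfl⟩ : ({(F : DigraphType)} : Set _))).term)
      (t₂ := Language.Term.var i)).symm
  · constructor
    · rintro ⟨F, hF, h⟩
      exact Set.mem_iUnion.2 ⟨⟨_, hF⟩, h⟩
    · intro h
      obtain ⟨⟨F, hF⟩, h⟩ := Set.mem_iUnion.1 h
      obtain ⟨F, rfl⟩ := Quotient.exists_rep F
      exact ⟨F, hF, h⟩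

/-- The existence of at most four vertices forming a prescribed pattern is definable. -/
theorem pattern {k : ℕ} (hk : k ≤ 4) (hk' : 0 < k)
    (p : (Fin k → Fin k → Prop) → (Fin k → Fin k → Prop) → Prop) (i : α) :
    DefPred fun v => ∃ t : Fin k → (v i).V,
      p (fun a b => (v i).graph.Adj (t a) (t b)) (fun a b => t a = t b) := by
  let T : FinDigraph → Prop := fun G => ∃ t : Fin k → G.V,
      p (fun a b => G.graph.Adj (t a) (t b)) (fun a b => t a = t b)
  let S : Set DigraphType := {x | x ∈ small ∧ ∃ F, Quotient.mk _ F = x ∧ T F}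
  -- The pattern persists in larger digraphs and is already present on the range of `t`, which has
  -- at most four vertices. So it occurs exactly when some constant with the pattern is a
  -- substructure.
  have hT : ∀ {F G : FinDigraph}, F.IsSub G → T F → T G := by
    rintro F G hFG ⟨t, ht⟩
    obtain ⟨f⟩ := (FinDigraph.isSub_iff _ _).1 hFG
    refine ⟨f ∘ t, ?_⟩
    simpa only [Function.comp, f.map_rel_iff, f.injective.eq_iff] using ht
  refine (exists_small_isSub S (fun x hx => hx.1) i).congr fun v => ⟨?_, ?_⟩
  · rintro ⟨t, ht⟩
    have hne : (Set.range t).Nonempty := ⟨t ⟨0, hk'⟩, Set.mem_range_self _⟩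
    refine ⟨(v i).ind (Set.range t) hne, ⟨?_, _, rfl, ?_⟩, FinDigraph.ind_isSub _ _ _⟩
    · change Nat.card (Set.range t) ≤ 4
      exact (Nat.card_le_card_of_surjective _ Set.rangeFactorization_surjective).trans (by simpa using hk)
    · refine ⟨fun a => ⟨t a, Set.mem_range_self a⟩, ?_⟩
      simpa only [FinDigraph.ind, Subtype.mk.injEq] using ht
  · rintro ⟨F, ⟨-, F', hF', h⟩, hF⟩
    obtain ⟨e⟩ := Quotient.exact hF'
    exact hT (((FinDigraph.isSub_iff _ _).2 ⟨e.toRelEmbedding⟩).trans hF) h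

end DefPred

/-! ### Translating formulas from a definable relation to the substructure order -/

namespace DigraphType

open Language

/-- Formulas over `(𝒟; r)` translate to formulas over `(𝒟; ⊑)` when `r` is definable there. -/
theorem definable_realize_of_definable {r : DigraphType → DigraphType → Prop}
    (hr : small.Definable Language.order {x : Fin 2 → DigraphType | r (x 0) (x 1)})
    {α : Type} {l : ℕ} (φ : Language.order.BoundedFormula α l) :
    small.Definable Language.order {v : α ⊕ Fin l → DigraphType |
      @BoundedFormula.Realize _ _ (relStructure r) _ _ φ (v ∘ Sum.inl) (v ∘ Sum.inr)} := by
  -- The language has no function symbols, so every term is a variable.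
  have hterm : ∀ {β : Type} (t : Language.order.Term β),
      ∃ i, ∀ v : β → DigraphType, @Term.realize _ _ (relStructure r) _ v t = v i := by
    intro β t
    cases t with
    | var i => exact ⟨i, fun _ => rfl⟩
    | func f _ => exact f.elim
  induction φ with
  | falsum => exact Set.definable_empty
  | equal t₁ t₂ =>
    obtain ⟨i, hi⟩ := hterm t₁
    obtain ⟨j, hj⟩ := hterm t₂
    simp only [BoundedFormula.Realize, hi, hj, Sum.elim_comp_inl_inr]
    refine ((Set.Definable.diagonal Language.order small).preimage_comp ![i, j])
  | rel R ts =>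
    cases R with
    | le =>
      obtain ⟨i, hi⟩ := hterm (ts 0)
      obtain ⟨j, hj⟩ := hterm (ts 1)
      have := hr.preimage_comp ![i, j]
      convert! this using 1
      ext v
      simp only [Set.mem_ofPred_eq, BoundedFormula.Realize, Sum.elim_comp_inl_inr, Set.mem_preimage]
      change r (@Term.realize _ _ (relStructure r) _ v (ts 0))
        (@Term.realize _ _ (relStructure r) _ v (ts 1)) ↔ _
      rw [hi, hj]
      rfl
  | imp f g hf hg =>
    convert! hf.compl.union hg using 1
    ext v
    exact imp_iff_not_or
  | @all n f hf =>
    -- The last bound variable becomes the `Unit` index over which the quantifier ranges.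
    let g : α ⊕ Fin (n + 1) → (α ⊕ Fin n) ⊕ Unit :=
      Sum.elim (fun a => .inl (.inl a)) (Fin.lastCases (.inr ()) fun j => .inl (.inr j))
    have := (hf.preimage_comp g).forall_of_finite
    convert! this using 1
    ext v
    have key : ∀ u : Unit → DigraphType, (Sum.elim v u ∘ g) ∘ Sum.inr =
        Fin.snoc (α := fun _ => DigraphType) (v ∘ Sum.inr) (u ()) := by
      intro u
      funext j
      refine Fin.lastCases ?_ (fun j => ?_) j <;> simp [g]
    have key' : ∀ u : Unit → DigraphType, (Sum.elim v u ∘ g) ∘ Sum.inl = v ∘ Sum.inl := 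
      fun u => rfl
    simp only [Set.mem_ofPred_eq, BoundedFormula.Realize, Set.mem_preimage, key, key']
    exact ⟨fun h u => h _, fun h x => h fun _ => x⟩

theorem definableIn_of_definableIn_empty {r : DigraphType → DigraphType → Prop}
    (hr : DefinableIn IsSub small {x : Fin 2 → DigraphType | r (x 0) (x 1)}) {n : ℕ}
    (R : Set (Fin n → DigraphType)) (hR : DefinableIn r ∅ R) : DefinableIn IsSub small R := by
  obtain ⟨φ, rfl⟩ := (@Set.empty_definable_iff _ _ (relStructure r) _ _).1 hR
  have := (definable_realize_of_definable hr φ).preimage_comp (Sum.elim id Fin.elim0)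
  convert! this using 1
  ext v
  simp only [Set.mem_preimage, Set.mem_ofPred_eq, Formula.Realize]
  rw [Subsingleton.elim ((v ∘ Sum.elim id Fin.elim0) ∘ Sum.inr) default]
  rfl

end DigraphType

/-! ### Patterns on two, three and four named vertices -/

namespace DefPred

variable {α : Type}

theorem pattern₂ (p : (Fin 2 → Fin 2 → Prop) → (Fin 2 → Fin 2 → Prop) → Prop) (i : α) :
    DefPred fun v => ∃ x y : (v i).V,
      p (fun a b => (v i).graph.Adj (![x, y] a) (![x, y] b))
        (fun a b => ![x, y] a = ![x, y] b) :=
  (pattern (by norm_num) (by norm_num) p i).congr fun v =>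
    ⟨fun ⟨x, y, h⟩ => ⟨![x, y], h⟩, fun ⟨t, h⟩ => ⟨t 0, t 1, by
      rwa [show ![t 0, t 1] = t from funext fun a => by fin_cases a <;> rfl]⟩⟩

theorem pattern₃ (p : (Fin 3 → Fin 3 → Prop) → (Fin 3 → Fin 3 → Prop) → Prop) (i : α) :
    DefPred fun v => ∃ x y z : (v i).V,
      p (fun a b => (v i).graph.Adj (![x, y, z] a) (![x, y, z] b))
        (fun a b => ![x, y, z] a = ![x, y, z] b) :=
  (pattern (by norm_num) (by norm_num) p i).congr fun v =>
    ⟨fun ⟨x, y, z, h⟩ => ⟨![x, y, z], h⟩, fun ⟨t, h⟩ => ⟨t 0, t 1, t 2, by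
      rwa [show ![t 0, t 1, t 2] = t from funext fun a => by fin_cases a <;> rfl]⟩⟩

theorem pattern₄ (p : (Fin 4 → Fin 4 → Prop) → (Fin 4 → Fin 4 → Prop) → Prop) (i : α) :
    DefPred fun v => ∃ x y z w : (v i).V,
      p (fun a b => (v i).graph.Adj (![x, y, z, w] a) (![x, y, z, w] b))
        (fun a b => ![x, y, z, w] a = ![x, y, z, w] b) :=
  (pattern (by norm_num) (by norm_num) p i).congr fun v =>
    ⟨fun ⟨x, y, z, w, h⟩ => ⟨![x, y, z, w], h⟩, fun ⟨t, h⟩ => ⟨t 0, t 1, t 2, t 3, by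
      rwa [show ![t 0, t 1, t 2, t 3] = t from funext fun a => by fin_cases a <;> rfl]⟩⟩

end DefPred

/-! ### The vocabulary of the formula for embeddability -/

namespace FinDigraph

/-- The edge relation of a finite digraph. -/
abbrev Adj (G : FinDigraph) : G.V → G.V → Prop := G.graph.Adj

/-- All pairs of vertices are edges, including the loops. -/
def IsFull (X : FinDigraph) : Prop := ∀ x y, X.Adj x y

/-- There are no edges. -/
def IsEdgeless (X : FinDigraph) : Prop := ∀ x y, ¬ X.Adj x y

/-- There are at least two vertices. -/
def IsNontrivial (X : FinDigraph) : Prop := ∃ x y : X.V, x ≠ y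

/-- Every vertex has a loop. -/
def IsReflexive (X : FinDigraph) : Prop := ∀ x, X.Adj x x

/-- In an extension of a full digraph by one vertex `x`: no edges enter `x`. -/
def NoEdgeIn (W : FinDigraph) : Prop :=
  (∃ x q p, q ≠ p ∧ W.Adj q p ∧ W.Adj p q ∧ ¬ W.Adj q x ∧ ¬ W.Adj p x) ∧
  ¬ ∃ x q p, q ≠ p ∧ W.Adj q p ∧ W.Adj p q ∧ W.Adj q x ∧ ¬ W.Adj p x

/-- In an extension of a full digraph by one vertex `x`: `x` is loopless and joined to all other
vertices in both directions. -/
def LooplessJoin (W : FinDigraph) : Prop :=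
  (∃ x, ¬ W.Adj x x) ∧ ∀ x y, x ≠ y → W.Adj x y

/-- In an extension of an edgeless digraph by one vertex `x`: the edges between `x` and the other
vertices are exactly those that start in `x`. -/
def AllEdgesOut (W : FinDigraph) : Prop :=
  (∃ x r s, r ≠ s ∧ ¬ W.Adj r s ∧ ¬ W.Adj s r ∧
    W.Adj x r ∧ W.Adj x s ∧ ¬ W.Adj r x ∧ ¬ W.Adj s x) ∧
  ¬ ∃ x r s, r ≠ s ∧ ¬ W.Adj r s ∧ ¬ W.Adj s r ∧ x ≠ s ∧
    W.Adj x r ∧ ¬ W.Adj r x ∧ ¬ (W.Adj x s ∧ ¬ W.Adj s x)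

/-- In an extension of an edgeless digraph by one vertex `x`: `x` has a loop and is joined to all
other vertices in both directions. -/
def LoopedJoin (W : FinDigraph) : Prop :=
  (∃ x, W.Adj x x) ∧ ∀ x y, x ≠ y → (W.Adj x x ∨ W.Adj y y) → W.Adj x y

/-- Two adjacent loopless vertices joined in both directions to a common looped vertex. -/
def HasAdjLooplessPair (X : FinDigraph) : Prop :=
  ∃ q x y, X.Adj q q ∧ ¬ X.Adj x x ∧ ¬ X.Adj y y ∧ X.Adj q x ∧ X.Adj x q ∧ X.Adj q y ∧
    X.Adj y q ∧ X.Adj x y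

/-- Two looped vertices, one of the two edges between them missing, joined in both directions to a
common loopless vertex. -/
def HasNonadjLoopedPair (X : FinDigraph) : Prop :=
  ∃ r x y, ¬ X.Adj r r ∧ X.Adj x x ∧ X.Adj y y ∧ X.Adj r x ∧ X.Adj x r ∧ X.Adj r y ∧
    X.Adj y r ∧ ¬ X.Adj x y

/-- Some pair of vertices is joined in exactly one direction. -/
def HasArrow (X : FinDigraph) : Prop := ∃ x y, X.Adj x y ∧ ¬ X.Adj y x

/-- Distinct vertices are joined by an edge. -/
def IsSemicomplete (X : FinDigraph) : Prop := ∀ x y, x ≠ y → X.Adj x y ∨ X.Adj y x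

/-- In an extension of a full digraph by two vertices: some `q` is an out-neighbour of `y` and not
of `x`. -/
def HasSeparated (X : FinDigraph) : Prop :=
  ∃ x y q q', q ≠ q' ∧ X.Adj q q' ∧ X.Adj q' q ∧ X.Adj y q ∧ ¬ X.Adj q y ∧ ¬ X.Adj x q

/-- As `HasSeparated`, with an edge from `x` to `y`. -/
def HasUpEdge (X : FinDigraph) : Prop :=
  ∃ x y q q', q ≠ q' ∧ X.Adj q q' ∧ X.Adj q' q ∧ X.Adj y q ∧ ¬ X.Adj q y ∧ ¬ X.Adj x q ∧ X.Adj x y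

/-- As `HasSeparated`, with an edge from `y` to `x`. -/
def HasDownEdge (X : FinDigraph) : Prop :=
  ∃ x y q q', q ≠ q' ∧ X.Adj q q' ∧ X.Adj q' q ∧ X.Adj y q ∧ ¬ X.Adj q y ∧ ¬ X.Adj x q ∧ X.Adj y x

/-- In an extension of a full digraph by two vertices: the out-neighbourhoods of the two vertices
are incomparable. -/
def HasCrossing (X : FinDigraph) : Prop :=
  ∃ x y q q', q ≠ q' ∧ X.Adj q q' ∧ X.Adj q' q ∧ X.Adj x q ∧ ¬ X.Adj q x ∧ ¬ X.Adj x q' ∧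
    X.Adj y q' ∧ ¬ X.Adj q' y ∧ ¬ X.Adj y q

/-- `W` is an extension of `K` by one vertex. -/
def Covers (K W : FinDigraph) : Prop :=
  K.IsSub W ∧ ¬ W.IsSub K ∧ ∀ Y : FinDigraph, K.IsSub Y → Y.IsSub W → Y.IsSub K ∨ W.IsSub Y

/-- `X` is an extension of `K` by two vertices. -/
def Covers₂ (K X : FinDigraph) : Prop := ∃ W, Covers K W ∧ Covers W X

/-- `Z` contains `K`, and each one-vertex extension of `K` inside `Z` satisfies `T`. -/
def AllCovers (T : FinDigraph → Prop) (K Z : FinDigraph) : Prop :=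
  K.IsSub Z ∧ ∀ W, Covers K W → W.IsSub Z → T W

/-- Each two-vertex extension of `K` inside `Z` satisfies `T`. -/
def AllCovers₂ (T : FinDigraph → Prop) (K Z : FinDigraph) : Prop :=
  ∀ X, Covers₂ K X → X.IsSub Z → T X

/-- `A` is the largest subdigraph of `Z` all of whose one-vertex extensions of `K` satisfy `T`. -/
def IsLargest (T : FinDigraph → Prop) (K Z A : FinDigraph) : Prop :=
  A.IsSub Z ∧ AllCovers T K A ∧ ∀ B : FinDigraph, B.IsSub Z → AllCovers T K B → B.IsSub A

/-- `Z` is composed of a copy of the full digraph `K`, a copy of the edgeless digraph `E`, and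
further vertices; `A` and `B` are obtained by deleting `E` and `K` respectively. -/
def IsFrame (K E Z A B : FinDigraph) : Prop :=
  (IsFull K ∧ IsNontrivial K ∧ IsEdgeless E ∧ IsNontrivial E) ∧
  AllCovers (fun W => NoEdgeIn W ∨ LooplessJoin W) K Z ∧
  AllCovers₂ (fun X => ¬ HasAdjLooplessPair X) K Z ∧
  AllCovers (fun W => AllEdgesOut W ∨ LoopedJoin W) E Z ∧
  AllCovers₂ (fun X => ¬ HasNonadjLoopedPair X) E Z ∧
  IsLargest NoEdgeIn K Z A ∧ IsLargest AllEdgesOut E Z B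

/-- `G` is the greatest lower bound of `A` and `B`. -/
def IsMeet (G A B : FinDigraph) : Prop := ∀ X : FinDigraph, X.IsSub G ↔ X.IsSub A ∧ X.IsSub B

/-- The vertices of `A` outside the copy of `K` are separated by their out-neighbourhoods in `K`,
which form a chain. -/
def IsNumbered (K A : FinDigraph) : Prop :=
  AllCovers₂ (fun X => HasSeparated X ∧ ¬ HasCrossing X) K A

/-- The full digraph `C` is not larger than the out-neighbourhood of the additional vertex of
`W`. -/
def NumberGE (W C : FinDigraph) : Prop :=
  IsFull C ∧ ∃ Y : FinDigraph, Y.IsSub W ∧ C.IsSub Y ∧ HasArrow Y ∧ IsSemicomplete Y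

/-- The additional vertices of `W` and `Y` have equally many out-neighbours. -/
def SameNumber (W Y : FinDigraph) : Prop := ∀ C, NumberGE W C ↔ NumberGE Y C

/-- Each additional vertex of `X` has a partner with the same number in `T`. -/
def SameNumbers (K X T : FinDigraph) : Prop :=
  ∀ W, Covers K W → W.IsSub X → ∃ Y, Covers K Y ∧ Y.IsSub T ∧ SameNumber W Y

/-- Matching the additional vertices of `A` to those of `A'` by their numbers gives an injective
homomorphism. -/
def NumberLE (K A A' : FinDigraph) : Prop :=
  (∀ W, Covers K W → W.IsSub A →
    ∃ Y, Covers K Y ∧ Y.IsSub A' ∧ SameNumber W Y ∧ (IsReflexive W → IsReflexive Y)) ∧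
  ∀ X, Covers₂ K X → X.IsSub A → ∀ T, Covers₂ K T → T.IsSub A' → SameNumbers K X T →
    (HasUpEdge X → HasUpEdge T) ∧ (HasDownEdge X → HasDownEdge T)

/-- The first-order description of embeddability in terms of the substructure order. -/
def EmbedsFormula (G H : FinDigraph) : Prop :=
  ∃ K E Z A B Z' A' B',
    (IsFrame K E Z A B ∧ IsMeet G A B ∧ IsNumbered K A) ∧
    (IsFrame K E Z' A' B' ∧ IsMeet H A' B' ∧ IsNumbered K A') ∧ NumberLE K A A'

end FinDigraph

/-! ### Definability of this vocabulary -/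

namespace DefPred

open FinDigraph

variable {α : Type}

theorem isFull (i : α) : DefPred fun v => IsFull (v i) :=
  (pattern₂ (fun r _ => ¬ r 0 1) i).not.congr fun v => by simp [IsFull]

theorem isEdgeless (i : α) : DefPred fun v => IsEdgeless (v i) :=
  (pattern₂ (fun r _ => r 0 1) i).not.congr fun v => by simp [IsEdgeless]

theorem isNontrivial (i : α) : DefPred fun v => IsNontrivial (v i) :=
  pattern₂ (fun _ e => ¬ e 0 1) i

theorem isReflexive (i : α) : DefPred fun v => IsReflexive (v i) :=
  (pattern₂ (fun r e => e 0 1 ∧ ¬ r 0 1) i).not.congr fun v => by simp [IsReflexive]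

theorem noEdgeIn (i : α) : DefPred fun v => NoEdgeIn (v i) :=
  (pattern₃ (fun r e => ¬ e 1 2 ∧ r 1 2 ∧ r 2 1 ∧ ¬ r 1 0 ∧ ¬ r 2 0) i).and
    (pattern₃ (fun r e => ¬ e 1 2 ∧ r 1 2 ∧ r 2 1 ∧ r 1 0 ∧ ¬ r 2 0) i).not

theorem looplessJoin (i : α) : DefPred fun v => LooplessJoin (v i) :=
  ((isReflexive i).not.and (pattern₂ (fun r e => ¬ e 0 1 ∧ ¬ r 0 1) i).not).congr fun v => by
    simp [IsReflexive, LooplessJoin]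

theorem allEdgesOut (i : α) : DefPred fun v => AllEdgesOut (v i) :=
  (pattern₃ (fun r e => ¬ e 1 2 ∧ ¬ r 1 2 ∧ ¬ r 2 1 ∧ r 0 1 ∧ r 0 2 ∧ ¬ r 1 0 ∧ ¬ r 2 0) i).and
    (pattern₃ (fun r e => ¬ e 1 2 ∧ ¬ r 1 2 ∧ ¬ r 2 1 ∧ ¬ e 0 2 ∧ r 0 1 ∧ ¬ r 1 0 ∧
      ¬ (r 0 2 ∧ ¬ r 2 0)) i).not

theorem loopedJoin (i : α) : DefPred fun v => LoopedJoin (v i) :=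
  ((pattern₂ (fun r e => e 0 1 ∧ r 0 1) i).and
    (pattern₂ (fun r e => ¬ e 0 1 ∧ (r 0 0 ∨ r 1 1) ∧ ¬ r 0 1) i).not).congr fun v => by
    simp [LoopedJoin]

theorem hasAdjLooplessPair (i : α) : DefPred fun v => HasAdjLooplessPair (v i) :=
  pattern₃ (fun r _ => r 0 0 ∧ ¬ r 1 1 ∧ ¬ r 2 2 ∧ r 0 1 ∧ r 1 0 ∧ r 0 2 ∧ r 2 0 ∧ r 1 2) i

theorem hasNonadjLoopedPair (i : α) : DefPred fun v => HasNonadjLoopedPair (v i) :=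
  pattern₃ (fun r _ => ¬ r 0 0 ∧ r 1 1 ∧ r 2 2 ∧ r 0 1 ∧ r 1 0 ∧ r 0 2 ∧ r 2 0 ∧ ¬ r 1 2) i

theorem hasArrow (i : α) : DefPred fun v => HasArrow (v i) :=
  pattern₂ (fun r _ => r 0 1 ∧ ¬ r 1 0) i

theorem isSemicomplete (i : α) : DefPred fun v => IsSemicomplete (v i) :=
  (pattern₂ (fun r e => ¬ e 0 1 ∧ ¬ (r 0 1 ∨ r 1 0)) i).not.congr fun v => by
    simp only [IsSemicomplete, not_exists, not_and, not_not]; rfl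

theorem hasSeparated (i : α) : DefPred fun v => HasSeparated (v i) :=
  pattern₄ (fun r e => ¬ e 2 3 ∧ r 2 3 ∧ r 3 2 ∧ r 1 2 ∧ ¬ r 2 1 ∧ ¬ r 0 2) i

theorem hasUpEdge (i : α) : DefPred fun v => HasUpEdge (v i) :=
  pattern₄ (fun r e => ¬ e 2 3 ∧ r 2 3 ∧ r 3 2 ∧ r 1 2 ∧ ¬ r 2 1 ∧ ¬ r 0 2 ∧ r 0 1) i

theorem hasDownEdge (i : α) : DefPred fun v => HasDownEdge (v i) :=
  pattern₄ (fun r e => ¬ e 2 3 ∧ r 2 3 ∧ r 3 2 ∧ r 1 2 ∧ ¬ r 2 1 ∧ ¬ r 0 2 ∧ r 1 0) i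

theorem hasCrossing (i : α) : DefPred fun v => HasCrossing (v i) :=
  pattern₄ (fun r e => ¬ e 2 3 ∧ r 2 3 ∧ r 3 2 ∧ r 0 2 ∧ ¬ r 2 0 ∧ ¬ r 0 3 ∧ r 1 3 ∧ ¬ r 3 1 ∧
    ¬ r 1 2) i

theorem covers (i j : α) : DefPred fun v => Covers (v i) (v j) := by
  refine and (isSub _ _) (and (isSub _ _).not (all ?_))
  exact imp (isSub _ _) (imp (isSub _ _) (or (isSub _ _) (isSub _ _)))

theorem covers₂ (i j : α) : DefPred fun v => Covers₂ (v i) (v j) := by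
  refine ex ?_
  exact and (covers _ _) (covers _ _)

theorem allCovers {T : FinDigraph → Prop} (hT : ∀ {β : Type} (b : β), DefPred fun v => T (v b))
    (i j : α) : DefPred fun v => AllCovers T (v i) (v j) := by
  refine and (isSub _ _) (all ?_)
  exact imp (covers _ _) (imp (isSub _ _) (hT _))

theorem allCovers₂ {T : FinDigraph → Prop} (hT : ∀ {β : Type} (b : β), DefPred fun v => T (v b))
    (i j : α) : DefPred fun v => AllCovers₂ T (v i) (v j) := by
  refine all ?_
  exact imp (covers₂ _ _) (imp (isSub _ _) (hT _))

theorem isLargest {T : FinDigraph → Prop} (hT : ∀ {β : Type} (b : β), DefPred fun v => T (v b))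
    (i j k : α) : DefPred fun v => IsLargest T (v i) (v j) (v k) := by
  refine and (isSub _ _) (and (allCovers hT _ _) (all ?_))
  exact imp (isSub _ _) (imp (allCovers hT _ _) (isSub _ _))

theorem isFrame (i j k l m : α) : DefPred fun v => IsFrame (v i) (v j) (v k) (v l) (v m) :=
  and (and (isFull _) (and (isNontrivial _) (and (isEdgeless _) (isNontrivial _)))) <|
  and (allCovers (fun b => (noEdgeIn b).or (looplessJoin b)) _ _) <|
  and (allCovers₂ (fun b => (hasAdjLooplessPair b).not) _ _) <|
  and (allCovers (fun b => (allEdgesOut b).or (loopedJoin b)) _ _) <|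
  and (allCovers₂ (fun b => (hasNonadjLoopedPair b).not) _ _) <|
  and (isLargest noEdgeIn _ _ _) (isLargest allEdgesOut _ _ _)

theorem isMeet (i j k : α) : DefPred fun v => IsMeet (v i) (v j) (v k) := by
  refine all ?_
  exact iff (isSub _ _) (and (isSub _ _) (isSub _ _))

theorem isNumbered (i j : α) : DefPred fun v => IsNumbered (v i) (v j) :=
  allCovers₂ (fun b => (hasSeparated b).and (hasCrossing b).not) _ _

theorem numberGE (i j : α) : DefPred fun v => NumberGE (v i) (v j) := by
  refine and (isFull _) (ex ?_)
  exact and (isSub _ _) (and (isSub _ _) (and (hasArrow _) (isSemicomplete _)))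

theorem sameNumber (i j : α) : DefPred fun v => SameNumber (v i) (v j) := by
  refine all ?_
  exact iff (numberGE _ _) (numberGE _ _)

theorem sameNumbers (i j k : α) : DefPred fun v => SameNumbers (v i) (v j) (v k) := by
  refine all ?_
  refine imp (covers _ _) (imp (isSub _ _) (ex ?_))
  exact and (covers _ _) (and (isSub _ _) (sameNumber _ _))

theorem numberLE (i j k : α) : DefPred fun v => NumberLE (v i) (v j) (v k) := by
  refine and (all ?_) (all ?_)
  · refine imp (covers _ _) (imp (isSub _ _) (ex ?_))
    exact and (covers _ _) (and (isSub _ _) (and (sameNumber _ _)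
      (imp (isReflexive _) (isReflexive _))))
  · refine imp (covers₂ _ _) (imp (isSub _ _) (all ?_))
    exact imp (covers₂ _ _) (imp (isSub _ _) (imp (sameNumbers _ _ _)
      (and (imp (hasUpEdge _) (hasUpEdge _)) (imp (hasDownEdge _) (hasDownEdge _)))))

theorem embedsFormula (i j : α) : DefPred fun v => EmbedsFormula (v i) (v j) := by
  unfold EmbedsFormula
  iterate 8 refine ex ?_
  exact and (and (isFrame _ _ _ _ _) (and (isMeet _ _ _) (isNumbered _ _)))
    (and (and (isFrame _ _ _ _ _) (and (isMeet _ _ _) (isNumbered _ _))) (numberLE _ _ _))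

end DefPred

/-! ### Covers as one-vertex extensions -/

namespace FinDigraph

/-- Embeddings as induced subdigraphs. -/
abbrev Emb (G H : FinDigraph) : Type := G.graph.Adj ↪r H.graph.Adj

theorem Emb.isSub {G H : FinDigraph} (f : Emb G H) : G.IsSub H := (isSub_iff G H).2 ⟨f⟩

theorem IsSub.exists_emb {G H : FinDigraph} (h : G.IsSub H) : Nonempty (Emb G H) :=
  (isSub_iff G H).1 h

theorem Emb.card_le {G H : FinDigraph} (f : Emb G H) : Nat.card G.V ≤ Nat.card H.V :=
  haveI := H.finite
  Nat.card_le_card_of_injective f f.injective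

theorem Emb.surjective_of_card_le {G H : FinDigraph} (f : Emb G H)
    (h : Nat.card H.V ≤ Nat.card G.V) : Function.Surjective f := by
  have := H.finite
  have := G.finite
  exact (Nat.bijective_iff_injective_and_card f).2 ⟨f.injective, f.card_le.antisymm h⟩ |>.2

theorem Emb.isSub_of_card_le {G H : FinDigraph} (f : Emb G H)
    (h : Nat.card H.V ≤ Nat.card G.V) : H.IsSub G :=
  let e : G.graph.Adj ≃r H.graph.Adj :=
    ⟨Equiv.ofBijective f ⟨f.injective, f.surjective_of_card_le h⟩, f.map_rel_iff⟩
  Emb.isSub e.symm.toRelEmbedding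

/-- An embedding whose image avoids the complement of `S` is an embedding into `G.ind S`. -/
def Emb.codRestrict {F G : FinDigraph} (f : Emb F G) (S : Set G.V) (hS : S.Nonempty)
    (h : ∀ x, f x ∈ S) : Emb F (G.ind S hS) :=
  ⟨⟨fun x => ⟨f x, h x⟩, fun _ _ hxy => f.injective (congrArg Subtype.val hxy)⟩, f.map_rel_iff⟩

/-- The inclusion of an induced subdigraph. -/
def indEmb (G : FinDigraph) (S : Set G.V) (hS : S.Nonempty) : Emb (G.ind S hS) G :=
  ⟨⟨Subtype.val, Subtype.val_injective⟩, Iff.rfl⟩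

theorem range_indEmb (G : FinDigraph) (S : Set G.V) (hS : S.Nonempty) :
    Set.range (G.indEmb S hS) = S := Subtype.range_val

theorem card_of_range_compl_singleton {K W : FinDigraph} (k : Emb K W) {w : W.V}
    (hk : Set.range k = {w}ᶜ) : Nat.card W.V = Nat.card K.V + 1 := by
  have := W.finite
  rw [← Set.ncard_add_ncard_compl {w}, ← hk, Set.ncard_singleton, Set.ncard_range_of_injective k.injective,
    add_comm]

/-- The one-vertex extension of an embedded digraph by a further vertex. -/
theorem exists_extension {K Z : FinDigraph} (f : Emb K Z) {v : Z.V} (hv : v ∉ Set.range f) :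
    ∃ (W : FinDigraph) (g : Emb W Z) (k : Emb K W) (w : W.V),
      Set.range k = {w}ᶜ ∧ (k.trans g = f) ∧ g w = v := by
  refine ⟨Z.ind (insert v (Set.range f)) ⟨v, Set.mem_insert _ _⟩, Z.indEmb _ _,
    f.codRestrict _ _ fun x => Set.mem_insert_of_mem _ ⟨x, rfl⟩, ⟨v, Set.mem_insert _ _⟩, ?_,
    RelEmbedding.ext fun x => rfl, rfl⟩
  ext ⟨y, hy⟩
  constructor
  · rintro ⟨x, hx⟩ h
    exact hv ⟨x, congrArg Subtype.val (hx.trans h)⟩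
  · intro h
    rcases hy with rfl | ⟨x, rfl⟩
    · exact absurd rfl h
    · exact ⟨x, rfl⟩

/-- Between `K` and a larger `W` lies `K` with one further vertex of `W`, so a cover adds exactly
one vertex. Conversely, no order fits strictly between `n` and `n + 1`, and embedded digraphs of
equal order are isomorphic. -/
theorem covers_iff {K W : FinDigraph} :
    Covers K W ↔ ∃ (k : Emb K W) (w : W.V), Set.range k = {w}ᶜ := by
  have := W.finite
  constructor
  · rintro ⟨hKW, hWK, h⟩
    obtain ⟨f⟩ := hKW.exists_emb
    obtain ⟨v, hv⟩ : ∃ v, v ∉ Set.range f := by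
      by_contra! hc
      refine hWK (f.isSub_of_card_le ?_)
      have := K.finite
      exact Nat.card_le_card_of_surjective f hc
    obtain ⟨Y, g, k, w, hk, -, -⟩ := exists_extension f hv
    have hc := card_of_range_compl_singleton k hk
    rcases h Y k.isSub g.isSub with h | h
    · obtain ⟨j⟩ := h.exists_emb
      have := j.card_le
      omega
    · obtain ⟨j⟩ := h.exists_emb
      have hs := g.surjective_of_card_le j.card_le
      refine ⟨k.trans g, g w, ?_⟩
      rw [RelEmbedding.coe_trans, Set.range_comp, hk, Set.image_compl_eq ⟨g.injective, hs⟩,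
        Set.image_singleton]
  · rintro ⟨k, w, hk⟩
    have hc := card_of_range_compl_singleton k hk
    refine ⟨k.isSub, fun h => ?_, fun Y hKY hYW => ?_⟩
    · obtain ⟨j⟩ := h.exists_emb
      have := j.card_le
      omega
    · obtain ⟨f⟩ := hKY.exists_emb
      obtain ⟨g⟩ := hYW.exists_emb
      have := g.card_le
      by_cases h : Nat.card Y.V ≤ Nat.card K.V
      · exact .inl (f.isSub_of_card_le h)
      · exact .inr (g.isSub_of_card_le (by omega))

theorem covers₂_iff {K X : FinDigraph} :
    Covers₂ K X ↔ ∃ (k : Emb K X) (v w : X.V), v ≠ w ∧ Set.range k = {v, w}ᶜ := by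
  constructor
  · rintro ⟨W, hKW, hWX⟩
    obtain ⟨k, v, hk⟩ := covers_iff.1 hKW
    obtain ⟨j, w, hj⟩ := covers_iff.1 hWX
    have hv : j v ≠ w := fun h => by
      have : j v ∈ Set.range j := ⟨v, rfl⟩
      rw [hj, h] at this
      exact this rfl
    refine ⟨k.trans j, j v, w, hv, ?_⟩
    rw [RelEmbedding.coe_trans, Set.range_comp, hk, Set.image_compl_eq_range_sdiff_image
      j.injective, hj, Set.image_singleton]
    ext x
    simp [and_comm]
  · rintro ⟨k, v, w, hvw, hk⟩
    have hv : v ∉ Set.range k := by simp [hk]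
    obtain ⟨W, g, j, u, hj, hjg, rfl⟩ := exists_extension k hv
    refine ⟨W, covers_iff.2 ⟨j, u, hj⟩, covers_iff.2 ⟨g, w, ?_⟩⟩
    have h1 : Set.range g = insert (g u) (Set.range k) := by
      rw [← hjg, RelEmbedding.coe_trans, Set.range_comp, hj, Set.image_compl_eq_range_sdiff_image
        g.injective, Set.image_singleton, Set.insert_sdiff_singleton, Set.insert_eq_of_mem (Set.mem_range_self u)]
    rw [h1, hk]
    ext x
    simp only [Set.mem_insert_iff, Set.mem_compl_iff, Set.mem_singleton_iff]
    grind

/-- The two-vertex extension of an embedded digraph by further vertices. -/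
theorem exists_extension₂ {K Z : FinDigraph} (f : Emb K Z) {v w : Z.V} (hv : v ∉ Set.range f)
    (hw : w ∉ Set.range f) (hvw : v ≠ w) :
    ∃ (X : FinDigraph) (g : Emb X Z) (k : Emb K X) (v' w' : X.V),
      v' ≠ w' ∧ Set.range k = {v', w'}ᶜ ∧ k.trans g = f ∧ g v' = v ∧ g w' = w := by
  let S : Set Z.V := {v, w} ∪ Set.range f
  have hvS : v ∈ S := .inl (.inl rfl)
  have hwS : w ∈ S := .inl (.inr rfl)
  refine ⟨Z.ind S ⟨v, hvS⟩, Z.indEmb _ _, f.codRestrict _ _ fun x => .inr ⟨x, rfl⟩,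
    ⟨v, hvS⟩, ⟨w, hwS⟩, fun h => hvw (congrArg Subtype.val h), ?_,
    RelEmbedding.ext fun x => rfl, rfl, rfl⟩
  ext ⟨y, hy⟩
  constructor
  · rintro ⟨x, hx⟩ (h | h)
    · exact hv ⟨x, congrArg Subtype.val (hx.trans h)⟩
    · exact hw ⟨x, congrArg Subtype.val (hx.trans h)⟩
  · intro h
    rcases hy with (rfl | rfl) | ⟨x, rfl⟩
    · exact absurd (.inl rfl) h
    · exact absurd (.inr rfl) h
    · exact ⟨x, rfl⟩

/-- Passes from a property `T` of isomorphism types to a statement `S` about a given copy of `K` and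
a given vertex outside it. As `S` is local to the copy and the vertex, it can be checked in `Z` or
in the extension alike. -/
theorem allCovers_iff {T : FinDigraph → Prop} {K Z : FinDigraph}
    {S : ∀ Z : FinDigraph, Emb K Z → Z.V → Prop}
    (hT : ∀ (W : FinDigraph) (k : Emb K W) (w : W.V), Set.range k = {w}ᶜ → (T W ↔ S W k w))
    (hS : ∀ (W : FinDigraph) (k : Emb K W) (w : W.V) (g : Emb W Z),
      S Z (k.trans g) (g w) ↔ S W k w) :
    AllCovers T K Z ↔ K.IsSub Z ∧ ∀ (f : Emb K Z) (v : Z.V), v ∉ Set.range f → S Z f v := by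
  refine and_congr_right fun _ => ⟨fun h f v hv => ?_, fun h W hKW hWZ => ?_⟩
  · obtain ⟨W, g, k, w, hk, rfl, rfl⟩ := exists_extension f hv
    exact (hS _ _ _ _).2 ((hT _ _ _ hk).1 (h W (covers_iff.2 ⟨k, w, hk⟩) g.isSub))
  · obtain ⟨k, w, hk⟩ := covers_iff.1 hKW
    obtain ⟨g⟩ := hWZ.exists_emb
    refine (hT _ _ _ hk).2 ((hS _ _ _ g).1 (h _ _ ?_))
    rintro ⟨x, hx⟩
    have : k x ∈ Set.range k := ⟨x, rfl⟩
    rw [show k x = w from g.injective hx, hk] at this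
    exact this rfl

/-- In `hT` the extension may be assumed to lie inside `Z`: some patterns have the intended meaning
only when no edges leave the copy of `K`, which is known in `Z`. -/
theorem allCovers₂_iff {T : FinDigraph → Prop} {K Z : FinDigraph}
    {S : ∀ Z : FinDigraph, Emb K Z → Z.V → Z.V → Prop}
    (hT : ∀ (X : FinDigraph) (k : Emb K X) (v w : X.V), v ≠ w → Set.range k = {v, w}ᶜ → X.IsSub Z →
      (T X ↔ S X k v w))
    (hS : ∀ (X : FinDigraph) (k : Emb K X) (v w : X.V) (g : Emb X Z),
      S Z (k.trans g) (g v) (g w) ↔ S X k v w) :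
    AllCovers₂ T K Z ↔ ∀ (f : Emb K Z) (v w : Z.V), v ∉ Set.range f → w ∉ Set.range f → v ≠ w →
      S Z f v w := by
  refine ⟨fun h f v w hv hw hvw => ?_, fun h X hKX hXZ => ?_⟩
  · obtain ⟨X, g, k, v', w', hvw', hk, rfl, rfl, rfl⟩ := exists_extension₂ f hv hw hvw
    exact (hS _ _ _ _ _).2 ((hT _ _ _ _ hvw' hk g.isSub).1
      (h X (covers₂_iff.2 ⟨k, v', w', hvw', hk⟩) g.isSub))
  · obtain ⟨k, v, w, hvw, hk⟩ := covers₂_iff.1 hKX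
    obtain ⟨g⟩ := hXZ.exists_emb
    have key : ∀ x, k x ∉ ({v, w} : Set X.V) := fun x => by
      rw [← Set.mem_compl_iff, ← hk]; exact ⟨x, rfl⟩
    refine (hT _ _ _ _ hvw hk hXZ).2 ((hS _ _ _ _ g).1 (h _ _ _ ?_ ?_ (g.injective.ne hvw)))
    · rintro ⟨x, hx⟩
      exact key x (.inl (g.injective hx))
    · rintro ⟨x, hx⟩
      exact key x (.inr (g.injective hx))

end FinDigraph

/-! ### The meaning of the patterns in extensions of full and edgeless digraphs -/

namespace FinDigraph

variable {K W : FinDigraph}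

theorem Emb.eq_or_of_range {k : Emb K W} {w : W.V} (hk : Set.range k = {w}ᶜ) :
    (∀ y, y = w ∨ ∃ x, k x = y) ∧ ∀ x, k x ≠ w := by
  refine ⟨fun y => ?_, fun x => ?_⟩
  · by_cases h : y = w
    · exact .inl h
    · exact .inr (by rwa [← Set.mem_range, hk])
  · have : k x ∈ Set.range k := ⟨x, rfl⟩
    rwa [hk] at this

theorem Emb.eq_or_of_range₂ {k : Emb K W} {v w : W.V} (hk : Set.range k = {v, w}ᶜ) :
    (∀ y, y = v ∨ y = w ∨ ∃ x, k x = y) ∧ (∀ x, k x ≠ v) ∧ ∀ x, k x ≠ w := by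
  have : ∀ x, k x ∈ ({v, w} : Set W.V)ᶜ := fun x => hk ▸ ⟨x, rfl⟩
  simp only [Set.mem_compl_iff, Set.mem_insert_iff, Set.mem_singleton_iff, not_or] at this
  refine ⟨fun y => ?_, fun x => (this x).1, fun x => (this x).2⟩
  by_cases h : y = v ∨ y = w
  · tauto
  · exact .inr (.inr (by rw [← Set.mem_range, hk]; exact h))

theorem IsFull.adj (hK : IsFull K) (k : Emb K W) (x y : K.V) : W.Adj (k x) (k y) :=
  k.map_rel_iff.2 (hK x y)

theorem IsEdgeless.not_adj (hK : IsEdgeless K) (k : Emb K W) (x y : K.V) : ¬ W.Adj (k x) (k y) :=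
  fun h => hK x y (k.map_rel_iff.1 h)

theorem Emb.forall_iff {k : Emb K W} {w : W.V} (hk : Set.range k = {w}ᶜ) {p : W.V → Prop} :
    (∀ x, p (k x)) ↔ ∀ y, y ≠ w → p y := by
  obtain ⟨hc, hne⟩ := Emb.eq_or_of_range hk
  refine ⟨fun h y hy => ?_, fun h x => h _ (hne x)⟩
  obtain ⟨x, rfl⟩ := (hc y).resolve_left hy
  exact h x

theorem Emb.forall_iff₂ {k : Emb K W} {v w : W.V} (hk : Set.range k = {v, w}ᶜ) {p : W.V → Prop} :
    (∀ x, p (k x)) ↔ ∀ y, y ≠ v → y ≠ w → p y := by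
  obtain ⟨hc, hv, hw⟩ := Emb.eq_or_of_range₂ hk
  refine ⟨fun h y hy hy' => ?_, fun h x => h _ (hv x) (hw x)⟩
  obtain ⟨x, rfl⟩ := ((hc y).resolve_left hy).resolve_left hy'
  exact h x

theorem IsFull.adj_of_ne (hK : IsFull K) {k : Emb K W} {w : W.V} (hk : Set.range k = {w}ᶜ) :
    ∀ x y, x ≠ w → y ≠ w → W.Adj x y := fun x y hx hy =>
  (Emb.forall_iff hk (p := fun x => W.Adj x y)).1 (fun a => (Emb.forall_iff hk).1 (hK.adj k a) y hy)
    x hx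

theorem IsEdgeless.not_adj_of_ne (hK : IsEdgeless K) {k : Emb K W} {w : W.V}
    (hk : Set.range k = {w}ᶜ) : ∀ x y, x ≠ w → y ≠ w → ¬ W.Adj x y := fun x y hx hy =>
  (Emb.forall_iff hk (p := fun x => ¬ W.Adj x y)).1
    (fun a => (Emb.forall_iff hk (p := fun y => ¬ W.Adj (k a) y)).1 (hK.not_adj k a) y hy) x hx

theorem IsFull.adj_of_ne₂ (hK : IsFull K) {k : Emb K W} {v w : W.V}
    (hk : Set.range k = {v, w}ᶜ) :
    ∀ x y, x ≠ v → x ≠ w → y ≠ v → y ≠ w → W.Adj x y := fun x y hx hx' hy hy' =>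
  (Emb.forall_iff₂ hk (p := fun x => W.Adj x y)).1
    (fun a => (Emb.forall_iff₂ hk).1 (hK.adj k a) y hy hy') x hx hx'

theorem IsEdgeless.not_adj_of_ne₂ (hK : IsEdgeless K) {k : Emb K W} {v w : W.V}
    (hk : Set.range k = {v, w}ᶜ) :
    ∀ x y, x ≠ v → x ≠ w → y ≠ v → y ≠ w → ¬ W.Adj x y := fun x y hx hx' hy hy' =>
  (Emb.forall_iff₂ hk (p := fun x => ¬ W.Adj x y)).1
    (fun a => (Emb.forall_iff₂ hk (p := fun y => ¬ W.Adj (k a) y)).1 (hK.not_adj k a) y hy hy')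
    x hx hx'

/-- Of two distinct vertices at least one lies in the full part, and it sends edges to the whole
full part; so a vertex that receives none from either must be `w`. The first clause then gives one
core vertex without an edge to `w`, and the second, forbidding core vertices to disagree, spreads
this to all of them. -/
theorem noEdgeIn_iff (hK : IsFull K) (hK' : IsNontrivial K) {k : Emb K W} {w : W.V}
    (hk : Set.range k = {w}ᶜ) : NoEdgeIn W ↔ ∀ x, ¬ W.Adj (k x) w := by
  rw [Emb.forall_iff hk (p := fun x => ¬ W.Adj x w)]
  have hf := hK.adj_of_ne hk
  have hne := (Emb.eq_or_of_range hk).2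
  obtain ⟨a, b, hab⟩ := hK'
  constructor
  · rintro ⟨⟨x, q, q', h⟩, h'⟩ y hy hyw
    have hx : x = w := by grind +splitImp
    have hq : q ≠ w := by grind +splitImp
    subst hx
    refine h' ⟨x, y, q, ?_, ?_, ?_, hyw, h.2.2.2.1⟩ <;> grind +splitImp
  · intro h
    refine ⟨⟨w, k a, k b, k.injective.ne hab, hf _ _ (hne _) (hne _), hf _ _ (hne _) (hne _),
      h _ (hne _), h _ (hne _)⟩, ?_⟩
    rintro ⟨x, q, q', h'⟩
    grind +splitImp

theorem looplessJoin_iff (hK : IsFull K) {k : Emb K W} {w : W.V} (hk : Set.range k = {w}ᶜ) :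
    LooplessJoin W ↔ ¬ W.Adj w w ∧ ∀ x, W.Adj (k x) w ∧ W.Adj w (k x) := by
  rw [Emb.forall_iff hk (p := fun x => W.Adj x w ∧ W.Adj w x)]
  have hf := hK.adj_of_ne hk
  constructor
  · rintro ⟨⟨x, hx⟩, h⟩
    grind +splitImp
  · rintro ⟨h1, h2⟩
    exact ⟨⟨w, h1⟩, by grind +splitImp⟩

/-- A vertex with two distinct out-neighbours cannot lie in the edgeless part, so the first clause
singles out `w`; the second spreads the one-way edge from one core vertex to all. -/
theorem allEdgesOut_iff (hK : IsEdgeless K) (hK' : IsNontrivial K) {k : Emb K W} {w : W.V}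
    (hk : Set.range k = {w}ᶜ) : AllEdgesOut W ↔ ∀ x, W.Adj w (k x) ∧ ¬ W.Adj (k x) w := by
  rw [Emb.forall_iff hk (p := fun x => W.Adj w x ∧ ¬ W.Adj x w)]
  have hf := hK.not_adj_of_ne hk
  have hne := (Emb.eq_or_of_range hk).2
  obtain ⟨a, b, hab⟩ := hK'
  constructor
  · rintro ⟨⟨x, r, r', h⟩, h'⟩ y hy
    have hx : x = w := by grind +splitImp
    have hr : r ≠ w := by grind +splitImp
    subst hx
    by_contra hc
    refine h' ⟨x, r, y, ?_⟩
    grind +splitImp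
  · intro h
    refine ⟨⟨w, k a, k b, k.injective.ne hab, hf _ _ (hne _) (hne _), hf _ _ (hne _) (hne _),
      (h _ (hne _)).1, (h _ (hne _)).1, (h _ (hne _)).2, (h _ (hne _)).2⟩, ?_⟩
    rintro ⟨x, q, q', h'⟩
    grind +splitImp

theorem loopedJoin_iff (hK : IsEdgeless K) {k : Emb K W} {w : W.V} (hk : Set.range k = {w}ᶜ) :
    LoopedJoin W ↔ W.Adj w w ∧ ∀ x, W.Adj w (k x) ∧ W.Adj (k x) w := by
  rw [Emb.forall_iff hk (p := fun x => W.Adj w x ∧ W.Adj x w)]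
  have hf := hK.not_adj_of_ne hk
  constructor
  · rintro ⟨⟨x, hx⟩, h⟩
    grind +splitImp
  · rintro ⟨h1, h2⟩
    exact ⟨⟨w, h1⟩, by grind +splitImp⟩

theorem hasAdjLooplessPair_iff (hK : IsFull K) {k : Emb K W} {v w : W.V}
    (hk : Set.range k = {v, w}ᶜ) :
    HasAdjLooplessPair W ↔ ¬ W.Adj v v ∧ ¬ W.Adj w w ∧ (W.Adj v w ∨ W.Adj w v) ∧
      ∃ x, W.Adj (k x) v ∧ W.Adj v (k x) ∧ W.Adj (k x) w ∧ W.Adj w (k x) := by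
  have hf := hK.adj_of_ne₂ hk
  constructor
  · rintro ⟨q, x, y, h⟩
    have hx : x = v ∨ x = w := by grind +splitImp
    have hy : y = v ∨ y = w := by grind +splitImp
    obtain ⟨z, rfl⟩ : ∃ z, k z = q := by
      rcases (Emb.eq_or_of_range₂ hk).1 q with h | h | h
      · grind +splitImp
      · grind +splitImp
      · exact h
    grind +splitImp
  · rintro ⟨h1, h2, h3 | h3, x, h⟩
    · exact ⟨k x, v, w, hK.adj k _ _, by tauto⟩
    · exact ⟨k x, w, v, hK.adj k _ _, by tauto⟩

theorem hasNonadjLoopedPair_iff (hK : IsEdgeless K) {k : Emb K W} {v w : W.V}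
    (hk : Set.range k = {v, w}ᶜ) :
    HasNonadjLoopedPair W ↔ W.Adj v v ∧ W.Adj w w ∧ (¬ W.Adj v w ∨ ¬ W.Adj w v) ∧
      ∃ x, W.Adj (k x) v ∧ W.Adj v (k x) ∧ W.Adj (k x) w ∧ W.Adj w (k x) := by
  have hf := hK.not_adj_of_ne₂ hk
  constructor
  · rintro ⟨q, x, y, h⟩
    have hx : x = v ∨ x = w := by grind +splitImp
    have hy : y = v ∨ y = w := by grind +splitImp
    obtain ⟨z, rfl⟩ : ∃ z, k z = q := by
      rcases (Emb.eq_or_of_range₂ hk).1 q with h | h | h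
      · grind +splitImp
      · grind +splitImp
      · exact h
    grind +splitImp
  · rintro ⟨h1, h2, h3 | h3, x, h⟩
    · exact ⟨k x, v, w, hK.not_adj k _ _, by tauto⟩
    · exact ⟨k x, w, v, hK.not_adj k _ _, by tauto⟩

/-- `W` is an extension of the full digraph `K` by the vertices `v` and `w`, without edges from `K`
to `v` or `w`. -/
structure IsExtension₂ (k : Emb K W) (v w : W.V) : Prop where
  full : IsFull K
  nontrivial : IsNontrivial K
  range_eq : Set.range k = {v, w}ᶜ
  not_adj_left : ∀ x, ¬ W.Adj (k x) v
  not_adj_right : ∀ x, ¬ W.Adj (k x) w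

namespace IsExtension₂

variable {k : Emb K W} {v w : W.V}

/-- No edge leaves the core. If `q` were `v` or `w`, then `q'` and `y`, which send edges to `q`,
would both be outside the core; then `y` is `q` or `q'`, against the edge from `y` to `q` being
one-way. Hence `q` is in the core, so is its out-neighbour `q'`, and `y` is not. -/
theorem exists_of_mutual (h : IsExtension₂ k v w) {y q q' : W.V} (hqq : q ≠ q') (h1 : W.Adj q q')
    (h2 : W.Adj q' q) (h3 : W.Adj y q) (h4 : ¬ W.Adj q y) :
    (∃ z, k z = q) ∧ (∃ z, k z = q') ∧ (y = v ∨ y = w) := by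
  have hf := h.full.adj_of_ne₂ h.range_eq
  have hv := (Emb.forall_iff₂ h.range_eq (p := fun x => ¬ W.Adj x v)).1 h.not_adj_left
  have hw := (Emb.forall_iff₂ h.range_eq (p := fun x => ¬ W.Adj x w)).1 h.not_adj_right
  have hc := (Emb.eq_or_of_range₂ h.range_eq).1
  refine ⟨?_, ?_, by grind +splitImp⟩
  · rcases hc q with h | h | h
    · grind +splitImp
    · grind +splitImp
    · exact h
  · rcases hc q' with h | h | h
    · grind +splitImp
    · grind +splitImp
    · exact h

theorem eq_or_eq (h : IsExtension₂ k v w) {x : W.V} {z : K.V} (hx : ¬ W.Adj x (k z)) :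
    x = v ∨ x = w := by
  rcases (Emb.eq_or_of_range₂ h.range_eq).1 x with h' | h' | ⟨y, rfl⟩
  · exact .inl h'
  · exact .inr h'
  · exact absurd (h.full.adj k _ _) hx

theorem exists_ne (h : IsExtension₂ k v w) (z : K.V) : ∃ z', k z ≠ k z' := by
  obtain ⟨a, b, hab⟩ := h.nontrivial
  have := k.injective.ne hab
  by_cases h : k z = k a
  · exact ⟨b, h ▸ this⟩
  · exact ⟨a, h⟩

theorem hasSeparated_iff (h : IsExtension₂ k v w) : HasSeparated W ↔
      (∃ x, W.Adj w (k x) ∧ ¬ W.Adj v (k x)) ∨ ∃ x, W.Adj v (k x) ∧ ¬ W.Adj w (k x) := by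
  constructor
  · rintro ⟨x, y, q, q', h0, h1, h2, h3, h4, h5⟩
    obtain ⟨⟨z, rfl⟩, ⟨z', rfl⟩, hy⟩ := h.exists_of_mutual h0 h1 h2 h3 h4
    have hx := h.eq_or_eq h5
    grind +splitImp
  · rintro (⟨z, h1, h2⟩ | ⟨z, h1, h2⟩) <;> obtain ⟨z', hz'⟩ := h.exists_ne z
    · exact ⟨v, w, k z, k z', hz', h.full.adj k _ _, h.full.adj k _ _, h1, h.not_adj_right _, h2⟩
    · exact ⟨w, v, k z, k z', hz', h.full.adj k _ _, h.full.adj k _ _, h1, h.not_adj_left _, h2⟩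

theorem hasUpEdge_iff (h : IsExtension₂ k v w) : HasUpEdge W ↔
      (W.Adj v w ∧ ∃ x, W.Adj w (k x) ∧ ¬ W.Adj v (k x)) ∨
      (W.Adj w v ∧ ∃ x, W.Adj v (k x) ∧ ¬ W.Adj w (k x)) := by
  constructor
  · rintro ⟨x, y, q, q', h0, h1, h2, h3, h4, h5, h6⟩
    obtain ⟨⟨z, rfl⟩, ⟨z', rfl⟩, hy⟩ := h.exists_of_mutual h0 h1 h2 h3 h4
    have hx := h.eq_or_eq h5
    grind +splitImp
  · rintro (⟨h3, z, h1, h2⟩ | ⟨h3, z, h1, h2⟩) <;> obtain ⟨z', hz'⟩ := h.exists_ne z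
    · exact ⟨v, w, k z, k z', hz', h.full.adj k _ _, h.full.adj k _ _, h1, h.not_adj_right _, h2,
        h3⟩
    · exact ⟨w, v, k z, k z', hz', h.full.adj k _ _, h.full.adj k _ _, h1, h.not_adj_left _, h2,
        h3⟩

theorem hasDownEdge_iff (h : IsExtension₂ k v w) : HasDownEdge W ↔
      (W.Adj w v ∧ ∃ x, W.Adj w (k x) ∧ ¬ W.Adj v (k x)) ∨
      (W.Adj v w ∧ ∃ x, W.Adj v (k x) ∧ ¬ W.Adj w (k x)) := by
  constructor
  · rintro ⟨x, y, q, q', h0, h1, h2, h3, h4, h5, h6⟩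
    obtain ⟨⟨z, rfl⟩, ⟨z', rfl⟩, hy⟩ := h.exists_of_mutual h0 h1 h2 h3 h4
    have hx := h.eq_or_eq h5
    grind +splitImp
  · rintro (⟨h3, z, h1, h2⟩ | ⟨h3, z, h1, h2⟩) <;> obtain ⟨z', hz'⟩ := h.exists_ne z
    · exact ⟨v, w, k z, k z', hz', h.full.adj k _ _, h.full.adj k _ _, h1, h.not_adj_right _, h2,
        h3⟩
    · exact ⟨w, v, k z, k z', hz', h.full.adj k _ _, h.full.adj k _ _, h1, h.not_adj_left _, h2,
        h3⟩

theorem hasCrossing_iff (h : IsExtension₂ k v w) : HasCrossing W ↔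
      (∃ x, W.Adj w (k x) ∧ ¬ W.Adj v (k x)) ∧ ∃ x, W.Adj v (k x) ∧ ¬ W.Adj w (k x) := by
  constructor
  · rintro ⟨x, y, q, q', h0, h1, h2, h3, h4, h5, h6, h7, h8⟩
    obtain ⟨⟨z, rfl⟩, ⟨z', rfl⟩, hx⟩ := h.exists_of_mutual h0 h1 h2 h3 h4
    have hy := h.eq_or_eq h8
    grind +splitImp
  · rintro ⟨⟨z, h1, h2⟩, z', h1', h2'⟩
    exact ⟨w, v, k z, k z', by grind +splitImp, h.full.adj k _ _, h.full.adj k _ _, h1, h.not_adj_right _,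
      h2', h1', h.not_adj_left _, h2⟩

end IsExtension₂

end FinDigraph

/-! ### Frames: unique copies, largest parts, and the meet -/

namespace FinDigraph

variable {K E Z A B G : FinDigraph}

theorem allCovers_noEdgeIn_iff (hK : IsFull K) (hK' : IsNontrivial K) :
    AllCovers NoEdgeIn K Z ↔ K.IsSub Z ∧ ∀ (f : Emb K Z) (v : Z.V), v ∉ Set.range f →
      ∀ x, ¬ Z.Adj (f x) v :=
  allCovers_iff (S := fun Z f v => ∀ x, ¬ Z.Adj (f x) v)
    (fun _ _ _ hk => noEdgeIn_iff hK hK' hk)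
    (fun _ _ _ g => forall_congr' fun _ => not_congr g.map_rel_iff)

theorem allCovers_allEdgesOut_iff (hE : IsEdgeless E) (hE' : IsNontrivial E) :
    AllCovers AllEdgesOut E Z ↔ E.IsSub Z ∧ ∀ (f : Emb E Z) (v : Z.V), v ∉ Set.range f →
      ∀ x, Z.Adj v (f x) ∧ ¬ Z.Adj (f x) v :=
  allCovers_iff (S := fun Z f v => ∀ x, Z.Adj v (f x) ∧ ¬ Z.Adj (f x) v)
    (fun _ _ _ hk => allEdgesOut_iff hE hE' hk)
    (fun _ _ _ g => forall_congr' fun _ =>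
      and_congr g.map_rel_iff (not_congr g.map_rel_iff))

theorem allCovers_noEdgeIn_or_looplessJoin_iff (hK : IsFull K) (hK' : IsNontrivial K) :
    AllCovers (fun W => NoEdgeIn W ∨ LooplessJoin W) K Z ↔
      K.IsSub Z ∧ ∀ (f : Emb K Z) (v : Z.V), v ∉ Set.range f →
        (∀ x, ¬ Z.Adj (f x) v) ∨ (¬ Z.Adj v v ∧ ∀ x, Z.Adj (f x) v ∧ Z.Adj v (f x)) :=
  allCovers_iff (S := fun Z f v =>
      (∀ x, ¬ Z.Adj (f x) v) ∨ (¬ Z.Adj v v ∧ ∀ x, Z.Adj (f x) v ∧ Z.Adj v (f x)))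
    (fun _ _ _ hk => or_congr (noEdgeIn_iff hK hK' hk) (looplessJoin_iff hK hk))
    (fun _ _ _ g => or_congr (forall_congr' fun _ => not_congr g.map_rel_iff)
      (and_congr (not_congr g.map_rel_iff)
        (forall_congr' fun _ => and_congr g.map_rel_iff g.map_rel_iff)))

theorem allCovers_allEdgesOut_or_loopedJoin_iff (hE : IsEdgeless E) (hE' : IsNontrivial E) :
    AllCovers (fun W => AllEdgesOut W ∨ LoopedJoin W) E Z ↔
      E.IsSub Z ∧ ∀ (f : Emb E Z) (v : Z.V), v ∉ Set.range f →
        (∀ x, Z.Adj v (f x) ∧ ¬ Z.Adj (f x) v) ∨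
          (Z.Adj v v ∧ ∀ x, Z.Adj v (f x) ∧ Z.Adj (f x) v) :=
  allCovers_iff (S := fun Z f v => (∀ x, Z.Adj v (f x) ∧ ¬ Z.Adj (f x) v) ∨
          (Z.Adj v v ∧ ∀ x, Z.Adj v (f x) ∧ Z.Adj (f x) v))
    (fun _ _ _ hk => or_congr (allEdgesOut_iff hE hE' hk) (loopedJoin_iff hE hk))
    (fun _ _ _ g => or_congr
      (forall_congr' fun _ => and_congr g.map_rel_iff (not_congr g.map_rel_iff))
      (and_congr g.map_rel_iff (forall_congr' fun _ => and_congr g.map_rel_iff g.map_rel_iff)))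

theorem allCovers₂_not_hasAdjLooplessPair_iff (hK : IsFull K) :
    AllCovers₂ (fun X => ¬ HasAdjLooplessPair X) K Z ↔
      ∀ (f : Emb K Z) (v w : Z.V), v ∉ Set.range f → w ∉ Set.range f → v ≠ w →
        ¬ (¬ Z.Adj v v ∧ ¬ Z.Adj w w ∧ (Z.Adj v w ∨ Z.Adj w v) ∧
          ∃ x, Z.Adj (f x) v ∧ Z.Adj v (f x) ∧ Z.Adj (f x) w ∧ Z.Adj w (f x)) :=
  allCovers₂_iff (S := fun Z f v w =>
      ¬ (¬ Z.Adj v v ∧ ¬ Z.Adj w w ∧ (Z.Adj v w ∨ Z.Adj w v) ∧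
          ∃ x, Z.Adj (f x) v ∧ Z.Adj v (f x) ∧ Z.Adj (f x) w ∧ Z.Adj w (f x)))
    (fun _ _ _ _ _ hk _ => not_congr (hasAdjLooplessPair_iff hK hk))
    (fun _ k v w g => by simp only [RelEmbedding.trans_apply, Adj, g.map_rel_iff])

theorem allCovers₂_not_hasNonadjLoopedPair_iff (hE : IsEdgeless E) :
    AllCovers₂ (fun X => ¬ HasNonadjLoopedPair X) E Z ↔
      ∀ (f : Emb E Z) (v w : Z.V), v ∉ Set.range f → w ∉ Set.range f → v ≠ w →
        ¬ (Z.Adj v v ∧ Z.Adj w w ∧ (¬ Z.Adj v w ∨ ¬ Z.Adj w v) ∧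
          ∃ x, Z.Adj (f x) v ∧ Z.Adj v (f x) ∧ Z.Adj (f x) w ∧ Z.Adj w (f x)) :=
  allCovers₂_iff (S := fun Z f v w =>
      ¬ (Z.Adj v v ∧ Z.Adj w w ∧ (¬ Z.Adj v w ∨ ¬ Z.Adj w v) ∧
          ∃ x, Z.Adj (f x) v ∧ Z.Adj v (f x) ∧ Z.Adj (f x) w ∧ Z.Adj w (f x)))
    (fun _ _ _ _ _ hk _ => not_congr (hasNonadjLoopedPair_iff hE hk))
    (fun _ k v w g => by simp only [RelEmbedding.trans_apply, Adj, g.map_rel_iff])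

/-- `Z` is composed of a unique copy `Q` of `K`, a unique copy `R` of `E`, and further vertices. -/
structure FrameOn (K E Z : FinDigraph) (Q R : Set Z.V) : Prop where
  full : IsFull K
  nontrivial_left : IsNontrivial K
  edgeless : IsEdgeless E
  nontrivial_right : IsNontrivial E
  isSub_left : K.IsSub Z
  isSub_right : E.IsSub Z
  range_left : ∀ f : Emb K Z, Set.range f = Q
  range_right : ∀ f : Emb E Z, Set.range f = R
  join : ∀ q ∈ Q, ∀ r ∈ R, Z.Adj q r ∧ Z.Adj r q
  noEdgeIn : ∀ q ∈ Q, ∀ v ∉ Q, v ∉ R → ¬ Z.Adj q v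
  allEdgesOut : ∀ r ∈ R, ∀ v ∉ Q, v ∉ R → Z.Adj v r ∧ ¬ Z.Adj r v

/-- Relative to any pair of copies of `K` and `E`, a vertex outside both is of the kind expected of
`G`. A further copy would contain such a vertex, but it must also be joined in both directions to
the other part, which is impossible. -/
theorem IsFrame.exists_frameOn (h : IsFrame K E Z A B) : ∃ Q R : Set Z.V, FrameOn K E Z Q R := by
  obtain ⟨⟨hK, hK', hE, hE'⟩, ha, hc, hb, hd, -, -⟩ := h
  rw [allCovers_noEdgeIn_or_looplessJoin_iff hK hK'] at ha
  rw [allCovers₂_not_hasAdjLooplessPair_iff hK] at hc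
  rw [allCovers_allEdgesOut_or_loopedJoin_iff hE hE'] at hb
  rw [allCovers₂_not_hasNonadjLoopedPair_iff hE] at hd
  obtain ⟨hKZ, ha⟩ := ha
  obtain ⟨hEZ, hb⟩ := hb
  have hdisj : ∀ (f : Emb K Z) (e : Emb E Z) x y, f x ≠ e y := fun f e x y h =>
    hE.not_adj e y y (h ▸ hK.adj f x x)
  -- Seen from `E`, the vertex `f x` sends an edge to `e y`; seen from `K`, an edge from `K` to `e
  -- y` forces joining in both directions.
  have hjoin : ∀ (f : Emb K Z) (e : Emb E Z) x y, Z.Adj (f x) (e y) ∧ Z.Adj (e y) (f x) := by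
    intro f e x y
    rcases hb e (f x) (fun ⟨z, hz⟩ => hdisj f e x z hz.symm) with h | h
    · rcases ha f (e y) (fun ⟨z, hz⟩ => hdisj f e z y hz) with h' | h'
      · exact absurd (h y).1 (h' x)
      · exact h'.2 x
    · exact h.2 y
  obtain ⟨x₀⟩ := K.nonempty
  obtain ⟨y₀⟩ := E.nonempty
  -- If `v` were joined to `K` like a vertex of `E`, then `v` and `e y₀` would be adjacent loopless
  -- vertices joined to `f x₀`, a forbidden pair. If it were joined to `E` like a vertex of `K`,
  -- then `v` and `f x₀` would be a forbidden looped pair over `e y₀`.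
  have hrest : ∀ (f : Emb K Z) (e : Emb E Z) v, v ∉ Set.range f → v ∉ Set.range e →
      (∀ x, ¬ Z.Adj (f x) v) ∧ ∀ y, Z.Adj v (e y) ∧ ¬ Z.Adj (e y) v := by
    intro f e v hvf hve
    have h1 : ∀ x, ¬ Z.Adj (f x) v := by
      rcases ha f v hvf with h | ⟨hv, h⟩
      · exact h
      · rcases hb e v hve with h' | h'
        · exact absurd ⟨hv, hE.not_adj e y₀ y₀, .inl (h' y₀).1, x₀, (h x₀).1, (h x₀).2,
            hjoin f e x₀ y₀⟩ (hc f v (e y₀) hvf (fun ⟨z, hz⟩ => hdisj f e z y₀ hz)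
              fun h => hve ⟨y₀, h.symm⟩)
        · exact absurd h'.1 hv
    refine ⟨h1, ?_⟩
    rcases hb e v hve with h | ⟨hv, h⟩
    · exact h
    · exact absurd ⟨hv, hK.adj f x₀ x₀, .inr (h1 x₀), y₀, (h y₀).2, (h y₀).1,
        (hjoin f e x₀ y₀).2, (hjoin f e x₀ y₀).1⟩ (hd e v (f x₀) hve
          (fun ⟨z, hz⟩ => hdisj f e x₀ z hz.symm) fun h => hvf ⟨x₀, h.symm⟩)
  obtain ⟨f⟩ := hKZ.exists_emb
  obtain ⟨e⟩ := hEZ.exists_emb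
  have hf : ∀ f f' : Emb K Z, Set.range f' ⊆ Set.range f := by
    rintro f f' _ ⟨x, rfl⟩
    by_contra hx
    have := (hrest f e (f' x) hx fun ⟨z, hz⟩ => hdisj f' e x z hz.symm).2 y₀
    exact this.2 (hjoin f' e x y₀).2
  have he : ∀ e e' : Emb E Z, Set.range e' ⊆ Set.range e := by
    rintro e e' _ ⟨y, rfl⟩
    by_contra hy
    have := (hrest f e (e' y) (fun ⟨z, hz⟩ => hdisj f e' z y hz) hy).1 x₀
    exact this (hjoin f e' x₀ y).1
  refine ⟨Set.range f, Set.range e, hK, hK', hE, hE', hKZ, hEZ,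
    fun f' => (hf _ _).antisymm (hf _ _), fun e' => (he _ _).antisymm (he _ _), ?_, ?_, ?_⟩
  · rintro _ ⟨x, rfl⟩ _ ⟨y, rfl⟩
    exact hjoin f e x y
  · rintro _ ⟨x, rfl⟩ v hv hv'
    exact (hrest f e v hv hv').1 x
  · rintro _ ⟨y, rfl⟩ v hv hv'
    exact (hrest f e v hv hv').2 y

namespace FrameOn

variable {Q R : Set Z.V}

theorem mem_left (h : FrameOn K E Z Q R) (f : Emb K Z) (x : K.V) : f x ∈ Q := by
  rw [← h.range_left f]
  exact ⟨x, rfl⟩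

theorem mem_right (h : FrameOn K E Z Q R) (f : Emb E Z) (x : E.V) : f x ∈ R := by
  rw [← h.range_right f]
  exact ⟨x, rfl⟩

theorem adj_left (h : FrameOn K E Z Q R) : ∀ q ∈ Q, ∀ q' ∈ Q, Z.Adj q q' := by
  obtain ⟨f⟩ := h.isSub_left.exists_emb
  rw [← h.range_left f]
  rintro _ ⟨x, rfl⟩ _ ⟨y, rfl⟩
  exact h.full.adj f x y

theorem not_adj_right (h : FrameOn K E Z Q R) : ∀ r ∈ R, ∀ r' ∈ R, ¬ Z.Adj r r' := by
  obtain ⟨f⟩ := h.isSub_right.exists_emb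
  rw [← h.range_right f]
  rintro _ ⟨x, rfl⟩ _ ⟨y, rfl⟩
  exact h.edgeless.not_adj f x y

theorem disjoint (h : FrameOn K E Z Q R) : ∀ q ∈ Q, q ∉ R := fun q hq hr =>
  h.not_adj_right q hr q hr (h.adj_left q hq q hq)

theorem nonempty_compl_right (h : FrameOn K E Z Q R) : Rᶜ.Nonempty := by
  obtain ⟨f⟩ := h.isSub_left.exists_emb
  obtain ⟨x⟩ := K.nonempty
  exact ⟨f x, h.disjoint _ (h.mem_left f x)⟩

theorem nonempty_compl_left (h : FrameOn K E Z Q R) : Qᶜ.Nonempty := by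
  obtain ⟨f⟩ := h.isSub_right.exists_emb
  obtain ⟨x⟩ := E.nonempty
  exact ⟨f x, fun h' => h.disjoint _ h' (h.mem_right f x)⟩

/-- Every vertex of `R` receives edges from `Q`, so a subdigraph containing `K` in which no edge
leaves the copy of `K` must avoid `R`. -/
theorem isLargest_left (h : FrameOn K E Z Q R) :
    IsLargest NoEdgeIn K Z (Z.ind Rᶜ h.nonempty_compl_right) := by
  obtain ⟨f₀⟩ := h.isSub_left.exists_emb
  refine ⟨ind_isSub _ _ _, ?_, fun A' hA' hA => ?_⟩
  · rw [allCovers_noEdgeIn_iff h.full h.nontrivial_left]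
    refine ⟨(f₀.codRestrict Rᶜ _ fun x => h.disjoint _ (h.mem_left f₀ x)).isSub,
      fun f v hv x => ?_⟩
    have hr := h.range_left (f.trans (Z.indEmb _ _))
    refine h.noEdgeIn (f x).1 (h.mem_left (f.trans (Z.indEmb _ _)) x) v.1 ?_ v.2
    rw [← hr]
    rintro ⟨y, hy⟩
    exact hv ⟨y, Subtype.ext hy⟩
  · rw [allCovers_noEdgeIn_iff h.full h.nontrivial_left] at hA
    obtain ⟨g⟩ := hA'.exists_emb
    obtain ⟨f⟩ := hA.1.exists_emb
    obtain ⟨x⟩ := K.nonempty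
    refine (g.codRestrict Rᶜ _ fun a => ?_).isSub
    intro ha
    have haf : a ∉ Set.range f := by
      rintro ⟨y, rfl⟩
      exact h.disjoint _ (h.mem_left (f.trans g) y) ha
    exact hA.2 f a haf x (g.map_rel_iff.1 (h.join _ (h.mem_left (f.trans g) x) _ ha).1)

theorem isLargest_right (h : FrameOn K E Z Q R) :
    IsLargest AllEdgesOut E Z (Z.ind Qᶜ h.nonempty_compl_left) := by
  obtain ⟨f₀⟩ := h.isSub_right.exists_emb
  refine ⟨ind_isSub _ _ _, ?_, fun A' hA' hA => ?_⟩
  · rw [allCovers_allEdgesOut_iff h.edgeless h.nontrivial_right]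
    refine ⟨(f₀.codRestrict Qᶜ _ fun x h' => h.disjoint _ h' (h.mem_right f₀ x)).isSub,
      fun f v hv x => ?_⟩
    have hr := h.range_right (f.trans (Z.indEmb _ _))
    refine h.allEdgesOut (f x).1 (h.mem_right (f.trans (Z.indEmb _ _)) x) v.1 v.2 ?_
    rw [← hr]
    rintro ⟨y, hy⟩
    exact hv ⟨y, Subtype.ext hy⟩
  · rw [allCovers_allEdgesOut_iff h.edgeless h.nontrivial_right] at hA
    obtain ⟨g⟩ := hA'.exists_emb
    obtain ⟨f⟩ := hA.1.exists_emb
    obtain ⟨x⟩ := E.nonempty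
    refine (g.codRestrict Qᶜ _ fun a => ?_).isSub
    intro ha
    have haf : a ∉ Set.range f := by
      rintro ⟨y, rfl⟩
      exact h.disjoint _ ha (h.mem_right (f.trans g) y)
    exact (hA.2 f a haf x).2 (g.map_rel_iff.1 (h.join _ ha _ (h.mem_right (f.trans g) x)).2)

theorem isFrame (h : FrameOn K E Z Q R) :
    IsFrame K E Z (Z.ind Rᶜ h.nonempty_compl_right) (Z.ind Qᶜ h.nonempty_compl_left) := by
  refine ⟨⟨h.full, h.nontrivial_left, h.edgeless, h.nontrivial_right⟩, ?_, ?_, ?_, ?_,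
    h.isLargest_left, h.isLargest_right⟩
  · rw [allCovers_noEdgeIn_or_looplessJoin_iff h.full h.nontrivial_left]
    refine ⟨h.isSub_left, fun f v hv => ?_⟩
    have hq := h.mem_left f
    rw [h.range_left f] at hv
    by_cases hr : v ∈ R
    · exact .inr ⟨h.not_adj_right v hr v hr, fun x => h.join _ (hq x) _ hr⟩
    · exact .inl fun x => h.noEdgeIn _ (hq x) v hv hr
  · rw [allCovers₂_not_hasAdjLooplessPair_iff h.full]
    rintro f v w hv hw - ⟨-, -, hvw, x, h1, -, h2, -⟩
    have hq := h.mem_left f x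
    rw [h.range_left f] at hv hw
    have hv' : v ∈ R := by_contra fun hr => h.noEdgeIn _ hq v hv hr h1
    have hw' : w ∈ R := by_contra fun hr => h.noEdgeIn _ hq w hw hr h2
    exact hvw.elim (h.not_adj_right v hv' w hw') (h.not_adj_right w hw' v hv')
  · rw [allCovers_allEdgesOut_or_loopedJoin_iff h.edgeless h.nontrivial_right]
    refine ⟨h.isSub_right, fun f v hv => ?_⟩
    have hq := h.mem_right f
    rw [h.range_right f] at hv
    by_cases hr : v ∈ Q
    · exact .inr ⟨h.adj_left v hr v hr, fun x => h.join _ hr _ (hq x)⟩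
    · exact .inl fun x => h.allEdgesOut _ (hq x) v hr hv
  · rw [allCovers₂_not_hasNonadjLoopedPair_iff h.edgeless]
    rintro f v w hv hw - ⟨-, -, hvw, x, h1, -, h2, -⟩
    have hq := h.mem_right f x
    rw [h.range_right f] at hv hw
    have hv' : v ∈ Q := by_contra fun hr => (h.allEdgesOut _ hq v hr hv).2 h1
    have hw' : w ∈ Q := by_contra fun hr => (h.allEdgesOut _ hq w hr hw).2 h2
    exact hvw.elim (fun h' => h' (h.adj_left v hv' w hw')) (fun h' => h' (h.adj_left w hw' v hv'))

/-- A common subdigraph of the two parts avoids both distinguished copies. -/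
theorem exists_emb_compl (h : FrameOn K E Z Q R) {X : FinDigraph}
    (hA : X.IsSub (Z.ind Rᶜ h.nonempty_compl_right))
    (hB : X.IsSub (Z.ind Qᶜ h.nonempty_compl_left)) :
    ∃ g : Emb X Z, ∀ x, g x ∉ Q ∧ g x ∉ R := by
  obtain ⟨a⟩ := hA.exists_emb
  obtain ⟨b⟩ := hB.exists_emb
  by_cases ha : ∃ x, (a x).1 ∈ Q
  · by_cases hb : ∃ y, (b y).1 ∈ R
    · exfalso
      obtain ⟨x, hx⟩ := ha
      obtain ⟨y, hy⟩ := hb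
      -- Suppose `a` meets `Q` in `x` and `b` meets `R` in `y`. The loop at `x` keeps `b x` out of
      -- `R`, so `b` yields an edge from `x` to `y`. Since `y` is loopless, `a y` is outside `Q`,
      -- and `a` would carry this edge to one leaving `Q`. So one of the two embeddings avoids both
      -- copies.
      have hxx : X.Adj x x := a.map_rel_iff.1 (h.adj_left _ hx _ hx)
      have hyy : ¬ X.Adj y y := fun h' => h.not_adj_right _ hy _ hy (b.map_rel_iff.2 h')
      have hbx : (b x).1 ∉ R := fun h' => h.not_adj_right _ h' _ h' (b.map_rel_iff.2 hxx)
      have hay : (a y).1 ∉ Q := fun h' => hyy (a.map_rel_iff.1 (h.adj_left _ h' _ h'))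
      have hxy : X.Adj x y := b.map_rel_iff.1 (h.allEdgesOut _ hy _ (b x).2 hbx).1
      exact h.noEdgeIn _ hx _ hay (a y).2 (a.map_rel_iff.2 hxy)
    · exact ⟨b.trans (Z.indEmb _ _), fun x => ⟨(b x).2, fun hx => hb ⟨x, hx⟩⟩⟩
  · exact ⟨a.trans (Z.indEmb _ _), fun x => ⟨fun hx => ha ⟨x, hx⟩, (a x).2⟩⟩

theorem isMeet (h : FrameOn K E Z Q R) (e : Emb G Z) (he : Set.range e = (Q ∪ R)ᶜ) :
    IsMeet G (Z.ind Rᶜ h.nonempty_compl_right) (Z.ind Qᶜ h.nonempty_compl_left) := by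
  have he' : ∀ x, e x ∉ Q ∧ e x ∉ R := fun x => by
    have : e x ∈ (Q ∪ R)ᶜ := he ▸ ⟨x, rfl⟩
    simpa using this
  intro X
  constructor
  · intro hX
    exact ⟨hX.trans (e.codRestrict _ _ fun x => (he' x).2).isSub,
      hX.trans (e.codRestrict _ _ fun x => (he' x).1).isSub⟩
  · rintro ⟨hA, hB⟩
    obtain ⟨g, hg⟩ := h.exists_emb_compl hA hB
    have : ∀ x, ∃ y, e y = g x := fun x => by
      rw [← Set.mem_range, he]; simpa using hg x
    choose j hj using this
    refine Emb.isSub ⟨⟨j, fun x y hxy => g.injective ?_⟩, fun {x y} => ?_⟩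
    · rw [← hj, ← hj, hxy]
    · rw [← g.map_rel_iff, ← hj, ← hj, e.map_rel_iff]
      rfl

end FrameOn

/-- `A` has a unique copy `Q` of the full digraph `K`, and no edges leave `Q`. -/
structure CoreOn (K A : FinDigraph) (Q : Set A.V) : Prop where
  full : IsFull K
  nontrivial : IsNontrivial K
  isSub : K.IsSub A
  range_eq : ∀ f : Emb K A, Set.range f = Q
  noEdgeIn : ∀ q ∈ Q, ∀ v ∉ Q, ¬ A.Adj q v

/-- `A` and `G` are given only as a largest element and a meet, hence up to isomorphism. Mutual
embeddings of finite digraphs are bijective, which identifies `A` with `Rᶜ` and `G` with the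
complement of `Q ∪ R`. -/
theorem IsFrame.exists_coreOn (h : IsFrame K E Z A B) (hG : IsMeet G A B) :
    ∃ (Q : Set A.V) (e : Emb G A), CoreOn K A Q ∧ Set.range e = Qᶜ := by
  obtain ⟨Q, R, hF⟩ := h.exists_frameOn
  have hA := h.2.2.2.2.2.1
  have hB := h.2.2.2.2.2.2
  obtain ⟨a⟩ := (hF.isLargest_left.2.2 A hA.1 hA.2.1).exists_emb
  obtain ⟨a'⟩ := (hA.2.2 _ hF.isLargest_left.1 hF.isLargest_left.2.1).exists_emb
  have has := a.surjective_of_card_le a'.card_le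
  have hGA := (hG G).1 (IsSub.refl G)
  obtain ⟨g, hg⟩ := hF.exists_emb_compl (hGA.1.trans a.isSub)
    (hGA.2.trans (hF.isLargest_right.2.2 B hB.1 hB.2.1))
  have hne : ((Q ∪ R)ᶜ).Nonempty := by
    obtain ⟨x⟩ := G.nonempty
    exact ⟨g x, by simpa using hg x⟩
  have hm := hF.isMeet (Z.indEmb _ hne) (range_indEmb _ _ _)
  have hle : Nat.card (Z.ind _ hne).V ≤ Nat.card G.V := by
    have h1 := (hm _).1 (IsSub.refl _)
    obtain ⟨j⟩ := ((hG _).2 ⟨h1.1.trans a'.isSub,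
      h1.2.trans (hB.2.2 _ hF.isLargest_right.1 hF.isLargest_right.2.1)⟩).exists_emb
    exact j.card_le
  have hgs := (g.codRestrict _ hne fun x => by simpa using hg x).surjective_of_card_le hle
  have hlift : ∀ x, ∃ y, (a y).1 = g x := fun x => by
    obtain ⟨y, hy⟩ := has ⟨g x, (hg x).2⟩
    exact ⟨y, congrArg Subtype.val hy⟩
  choose j hj using hlift
  let e : Emb G A := ⟨⟨j, fun x y hxy => g.injective (by rw [← hj, ← hj, hxy])⟩, fun {x y} => by
    rw [← g.map_rel_iff, ← hj, ← hj]
    exact a.map_rel_iff.symm⟩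
  refine ⟨{x | (a x).1 ∈ Q}, e, ⟨hF.full, hF.nontrivial_left, ?_, fun f => ?_, ?_⟩, ?_⟩
  · exact hA.2.1.1
  · have := hF.range_left ((f.trans a).trans (Z.indEmb _ _))
    ext y
    constructor
    · rintro ⟨x, rfl⟩
      exact hF.mem_left ((f.trans a).trans (Z.indEmb _ _)) x
    · intro hy
      obtain ⟨x, hx⟩ := this.superset hy
      exact ⟨x, a.injective (Subtype.ext hx)⟩
  · intro q hq v hv hqv
    exact hF.noEdgeIn _ hq _ hv (a v).2 (a.map_rel_iff.2 hqv)
  · ext y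
    constructor
    · rintro ⟨x, rfl⟩ hx
      exact (hg x).1 (hj x ▸ hx)
    · intro hy
      obtain ⟨x, hx⟩ := hgs ⟨(a y).1, fun h' => h'.elim hy (a y).2⟩
      refine ⟨x, a.injective (Subtype.ext ?_)⟩
      exact (hj x).trans (congrArg Subtype.val hx)

end FinDigraph

/-! ### Numbers of vertices and their comparison between two frames -/

namespace FinDigraph

variable {K W C A A' X X' : FinDigraph}

/-- The number of out-neighbours of `v` in `Q`. -/
noncomputable def outDeg (A : FinDigraph) (Q : Set A.V) (v : A.V) : ℕ :=
  {q | q ∈ Q ∧ A.Adj v q}.ncard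

theorem outDeg_map (g : Emb W A) (Q : Set W.V) (w : W.V) :
    outDeg A (g '' Q) (g w) = outDeg W Q w := by
  rw [outDeg, outDeg, ← Set.ncard_image_of_injective _ g.injective]
  congr 1
  ext y
  constructor
  · rintro ⟨⟨x, hx, rfl⟩, h⟩
    exact ⟨x, ⟨hx, g.map_rel_iff.1 h⟩, rfl⟩
  · rintro ⟨x, ⟨hx, h⟩, rfl⟩
    exact ⟨⟨x, hx, rfl⟩, g.map_rel_iff.2 h⟩

/-- The full digraph with `n + 1` vertices. -/
def fullDigraph (n : ℕ) : FinDigraph := ⟨Fin (n + 1), ⟨fun _ _ => True⟩⟩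

theorem isFull_fullDigraph (n : ℕ) : IsFull (fullDigraph n) := fun _ _ => trivial

theorem card_fullDigraph (n : ℕ) : Nat.card (fullDigraph n).V = n + 1 :=
  Nat.card_fin (n + 1)

theorem IsFull.exists_emb (hC : IsFull C) {S : Set W.V} (hS : ∀ x ∈ S, ∀ y ∈ S, W.Adj x y)
    (h : Nat.card C.V ≤ S.ncard) : ∃ f : Emb C W, ∀ x, f x ∈ S := by
  have := C.finite
  have := W.finite
  have := Fintype.ofFinite C.V
  have := Fintype.ofFinite S
  obtain ⟨f⟩ : Nonempty (C.V ↪ S) := by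
    rw [Function.Embedding.nonempty_iff_card_le, ← Nat.card_eq_fintype_card,
      ← Nat.card_eq_fintype_card]
    exact h
  exact ⟨⟨f.trans (Function.Embedding.subtype _), fun {a b} =>
    iff_of_true (hS _ (f a).2 _ (f b).2) (hC a b)⟩, fun x => (f x).2⟩

/-- The arrow forces `Y` to contain `w`, as all other vertices of `W` are joined mutually.
Semicompleteness then forces the other vertices of `Y` to be out-neighbours of `w`, so full
subdigraphs of `Y` bound the out-degree from below. -/
theorem numberGE_iff (hK : IsFull K) {k : Emb K W} {w : W.V} (hk : Set.range k = {w}ᶜ)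
    (hw : ∀ x, ¬ W.Adj (k x) w) :
    NumberGE W C ↔ IsFull C ∧ Nat.card C.V ≤ outDeg W {w}ᶜ w := by
  have hWf := W.finite
  have hf := hK.adj_of_ne hk
  rw [Emb.forall_iff hk (p := fun x => ¬ W.Adj x w)] at hw
  refine and_congr_right fun hC => ⟨?_, fun h => ?_⟩
  · rintro ⟨Y, hYW, hCY, ⟨x, y, hxy, hyx⟩, hs⟩
    obtain ⟨g⟩ := hYW.exists_emb
    obtain ⟨c⟩ := hCY.exists_emb
    rw [Adj, ← g.map_rel_iff] at hxy hyx
    have hx : g x = w := by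
      by_contra hx
      by_cases hy : g y = w
      · exact hw _ hx (hy ▸ hxy)
      · exact hyx (hf _ _ hy hx)
    have hy : g y ≠ w := fun hy => by
      rw [hx, hy] at hxy hyx
      exact hyx hxy
    have hu : ∀ u, g u ≠ w → W.Adj w (g u) := fun u hu => by
      rcases hs x u (fun h => hu (h ▸ hx)) with h | h <;> rw [Adj, ← g.map_rel_iff, hx] at h
      · exact h
      · exact absurd h (hw _ hu)
    -- If `C` uses `w`, it is a single looped vertex, and the head of the arrow already gives
    -- out-degree at least one.
    by_cases hc : ∃ z, g (c z) = w
    · obtain ⟨z, hz⟩ := hc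
      have hall : ∀ z', g (c z') = w := fun z' => by
        by_contra hz'
        refine hw _ hz' ?_
        rw [← hz]
        exact g.map_rel_iff.2 (c.map_rel_iff.2 (hC _ _))
      have : Subsingleton C.V := ⟨fun a b => c.injective (g.injective
        ((hall a).trans (hall b).symm))⟩
      refine Finite.card_le_one_iff_subsingleton.2 this |>.trans ?_
      exact (Set.ncard_pos (Set.toFinite _)).2 ⟨g y, hy, hu y hy⟩
    · push Not at hc
      rw [← Set.ncard_univ, ← Set.ncard_image_of_injective _ (g.injective.comp c.injective)]
      refine Set.ncard_le_ncard ?_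
      rintro _ ⟨z, -, rfl⟩
      exact ⟨hc z, hu _ (hc z)⟩
  · have hS : ∀ x ∈ {q | q ∈ ({w}ᶜ : Set W.V) ∧ W.Adj w q},
        ∀ y ∈ {q | q ∈ ({w}ᶜ : Set W.V) ∧ W.Adj w q}, W.Adj x y :=
      fun x hx y hy => hf x y hx.1 hy.1
    obtain ⟨f, hfS⟩ := hC.exists_emb hS h
    obtain ⟨z⟩ := C.nonempty
    let T : Set W.V := insert w {q | q ∈ ({w}ᶜ : Set W.V) ∧ W.Adj w q}
    have hwT : w ∈ T := Set.mem_insert _ _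
    refine ⟨W.ind T ⟨w, hwT⟩, ind_isSub _ _ _,
      (f.codRestrict T _ fun x => Set.mem_insert_of_mem _ (hfS x)).isSub,
      ⟨⟨w, hwT⟩, ⟨f z, Set.mem_insert_of_mem _ (hfS z)⟩, (hfS z).2, hw _ (hfS z).1⟩, ?_⟩
    rintro ⟨a, rfl | ha⟩ ⟨b, rfl | hb⟩ hab
    · exact absurd rfl hab
    · exact .inl hb.2
    · exact .inr ha.2
    · exact .inl (hf _ _ ha.1 hb.1)

namespace CoreOn

variable {Q : Set A.V} {Q' : Set A'.V}

theorem mem (h : CoreOn K A Q) (f : Emb K A) (x : K.V) : f x ∈ Q := by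
  rw [← h.range_eq f]
  exact ⟨x, rfl⟩

theorem exists_mem_iff (h : CoreOn K A Q) (f : Emb K A) {p : A.V → Prop} :
    (∃ q ∈ Q, p q) ↔ ∃ x, p (f x) := by
  rw [← h.range_eq f]
  simp

theorem map_notMem (h : CoreOn K A Q) (k : Emb K W) {w : W.V} (hw : w ∉ Set.range k)
    (g : Emb W A) : g w ∉ Q := by
  rw [← h.range_eq (k.trans g)]
  rintro ⟨x, hx⟩
  exact hw ⟨x, g.injective hx⟩

theorem not_adj (h : CoreOn K A Q) (k : Emb K W) {w : W.V} (hw : w ∉ Set.range k) (g : Emb W A)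
    (x : K.V) : ¬ W.Adj (k x) w := fun h' =>
  h.noEdgeIn _ (h.mem (k.trans g) x) _ (h.map_notMem k hw g) (g.map_rel_iff.2 h')

theorem outDeg_eq (h : CoreOn K A Q) {k : Emb K W} {w : W.V} (hk : Set.range k = {w}ᶜ)
    (g : Emb W A) : outDeg A Q (g w) = outDeg W {w}ᶜ w := by
  rw [← outDeg_map g, ← hk, ← Set.range_comp, ← h.range_eq (k.trans g)]
  rfl

theorem sameNumber_iff {W' : FinDigraph} (h : CoreOn K A Q) (h' : CoreOn K A' Q') {k : Emb K W}
    {w : W.V} (hk : Set.range k = {w}ᶜ) (g : Emb W A) {k' : Emb K W'} {w' : W'.V}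
    (hk' : Set.range k' = {w'}ᶜ) (g' : Emb W' A') :
    SameNumber W W' ↔ outDeg A Q (g w) = outDeg A' Q' (g' w') := by
  have hw : w ∉ Set.range k := by simp [hk]
  have hw' : w' ∉ Set.range k' := by simp [hk']
  unfold SameNumber
  simp only [numberGE_iff h.full hk (h.not_adj k hw g),
    numberGE_iff h.full hk' (h'.not_adj k' hw' g'), h.outDeg_eq hk g, h'.outDeg_eq hk' g']
  refine ⟨fun H => ?_, fun H C => by rw [H]⟩
  have key : ∀ n, n + 1 ≤ outDeg W {w}ᶜ w ↔ n + 1 ≤ outDeg W' {w'}ᶜ w' := fun n => by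
    have := H (fullDigraph n)
    rwa [and_iff_right (isFull_fullDigraph n), and_iff_right (isFull_fullDigraph n),
      card_fullDigraph] at this
  -- Test digraphs have `n + 1` vertices. For out-degree zero the truncated subtraction tests with
  -- one vertex, which is what is needed.
  have h1 := key (outDeg W {w}ᶜ w - 1)
  have h2 := key (outDeg W' {w'}ᶜ w' - 1)
  omega

theorem isExtension₂ (h : CoreOn K A Q) {k : Emb K X} {v w : X.V} (hk : Set.range k = {v, w}ᶜ)
    (g : Emb X A) : IsExtension₂ k v w :=
  ⟨h.full, h.nontrivial, hk, h.not_adj k (by simp [hk]) g, h.not_adj k (by simp [hk]) g⟩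

/-- The vertices outside the core are linearly ordered by their out-neighbourhoods in it. -/
def Numbered (A : FinDigraph) (Q : Set A.V) : Prop :=
  ∀ v w, v ∉ Q → w ∉ Q → v ≠ w →
    ((∃ q ∈ Q, A.Adj w q ∧ ¬ A.Adj v q) ∨ ∃ q ∈ Q, A.Adj v q ∧ ¬ A.Adj w q) ∧
    ¬ ((∃ q ∈ Q, A.Adj w q ∧ ¬ A.Adj v q) ∧ ∃ q ∈ Q, A.Adj v q ∧ ¬ A.Adj w q)

theorem isNumbered_iff (h : CoreOn K A Q) : IsNumbered K A ↔ Numbered A Q := by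
  unfold IsNumbered
  rw [allCovers₂_iff (S := fun A f v w =>
    ((∃ x, A.Adj w (f x) ∧ ¬ A.Adj v (f x)) ∨ ∃ x, A.Adj v (f x) ∧ ¬ A.Adj w (f x)) ∧
    ¬ ((∃ x, A.Adj w (f x) ∧ ¬ A.Adj v (f x)) ∧ ∃ x, A.Adj v (f x) ∧ ¬ A.Adj w (f x)))]
  · constructor
    · intro H v w hv hw hvw
      obtain ⟨f⟩ := h.isSub.exists_emb
      rw [← h.range_eq f] at hv hw
      simp only [h.exists_mem_iff f]
      exact H f v w hv hw hvw
    · intro H f v w hv hw hvw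
      rw [h.range_eq f] at hv hw
      have := H v w hv hw hvw
      simpa only [h.exists_mem_iff f] using this
  · intro X k v w _ hk hX
    obtain ⟨g⟩ := hX.exists_emb
    have hext := h.isExtension₂ hk g
    rw [hext.hasSeparated_iff, hext.hasCrossing_iff]
  · intro X k v w g
    simp only [RelEmbedding.trans_apply, Adj, g.map_rel_iff]

/-- Out-neighbourhoods of distinct outer vertices are comparable and different, so inclusion and
cardinality order them alike. -/
theorem Numbered.outDeg_lt_iff (hN : Numbered A Q) {v w : A.V} (hv : v ∉ Q) (hw : w ∉ Q)
    (hvw : v ≠ w) : outDeg A Q v < outDeg A Q w ↔ ∃ q ∈ Q, A.Adj w q ∧ ¬ A.Adj v q := by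
  have := A.finite
  obtain ⟨h1, h2⟩ := hN v w hv hw hvw
  constructor
  · intro hlt
    by_contra! hc
    exact hlt.not_ge (Set.ncard_le_ncard fun q hq => ⟨hq.1, hc q hq.1 hq.2⟩)
  · rintro ⟨q, hq, hwq, hvq⟩
    refine Set.ncard_lt_ncard ⟨fun x hx => ⟨hx.1, ?_⟩, fun hs => hvq (hs ⟨hq, hwq⟩).2⟩
    by_contra hx'
    exact h2 ⟨⟨q, hq, hwq, hvq⟩, x, hx.1, hx.2, hx'⟩

theorem Numbered.outDeg_injOn (hN : Numbered A Q) {v w : A.V} (hv : v ∉ Q) (hw : w ∉ Q)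
    (h : outDeg A Q v = outDeg A Q w) : v = w := by
  by_contra hvw
  rcases (hN v w hv hw hvw).1 with h' | h'
  · exact ((hN.outDeg_lt_iff hv hw hvw).2 h').ne h
  · exact ((hN.outDeg_lt_iff hw hv (Ne.symm hvw)).2 h').ne h.symm

theorem hasUpEdge_iff (h : CoreOn K A Q) (hN : Numbered A Q) {k : Emb K X} {v w : X.V}
    (hvw : v ≠ w) (hk : Set.range k = {v, w}ᶜ) (g : Emb X A) :
    HasUpEdge X ↔ (A.Adj (g v) (g w) ∧ outDeg A Q (g v) < outDeg A Q (g w)) ∨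
      (A.Adj (g w) (g v) ∧ outDeg A Q (g w) < outDeg A Q (g v)) := by
  have hv := h.map_notMem k (w := v) (by simp [hk]) g
  have hw := h.map_notMem k (w := w) (by simp [hk]) g
  have hne := g.injective.ne hvw
  rw [(h.isExtension₂ hk g).hasUpEdge_iff, hN.outDeg_lt_iff hv hw hne,
    hN.outDeg_lt_iff hw hv hne.symm, h.exists_mem_iff (k.trans g), h.exists_mem_iff (k.trans g)]
  simp only [RelEmbedding.trans_apply, Adj, g.map_rel_iff]

theorem hasDownEdge_iff (h : CoreOn K A Q) (hN : Numbered A Q) {k : Emb K X} {v w : X.V}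
    (hvw : v ≠ w) (hk : Set.range k = {v, w}ᶜ) (g : Emb X A) :
    HasDownEdge X ↔ (A.Adj (g w) (g v) ∧ outDeg A Q (g v) < outDeg A Q (g w)) ∨
      (A.Adj (g v) (g w) ∧ outDeg A Q (g w) < outDeg A Q (g v)) := by
  have hv := h.map_notMem k (w := v) (by simp [hk]) g
  have hw := h.map_notMem k (w := w) (by simp [hk]) g
  have hne := g.injective.ne hvw
  rw [(h.isExtension₂ hk g).hasDownEdge_iff, hN.outDeg_lt_iff hv hw hne,
    hN.outDeg_lt_iff hw hv hne.symm, h.exists_mem_iff (k.trans g), h.exists_mem_iff (k.trans g)]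
  simp only [RelEmbedding.trans_apply, Adj, g.map_rel_iff]

theorem sameNumbers_iff (h : CoreOn K A Q) (h' : CoreOn K A' Q') {k : Emb K X} {v w : X.V}
    (hk : Set.range k = {v, w}ᶜ) (g : Emb X A) {k' : Emb K X'} {v' w' : X'.V}
    (hk' : Set.range k' = {v', w'}ᶜ) (g' : Emb X' A') :
    SameNumbers K X X' ↔ ∀ u, (u = v ∨ u = w) → ∃ u', (u' = v' ∨ u' = w') ∧
      outDeg A Q (g u) = outDeg A' Q' (g' u') := by
  constructor
  · intro H u hu
    have hu' : u ∉ Set.range k := by rw [hk]; exact not_not_intro hu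
    obtain ⟨W, j, k₁, w₁, hk₁, -, rfl⟩ := exists_extension k hu'
    obtain ⟨W', hW', hj', hs⟩ := H W (covers_iff.2 ⟨k₁, w₁, hk₁⟩) j.isSub
    obtain ⟨k₂, w₂, hk₂⟩ := covers_iff.1 hW'
    obtain ⟨j'⟩ := hj'.exists_emb
    refine ⟨j' w₂, ?_, (h.sameNumber_iff h' hk₁ (j.trans g) hk₂ (j'.trans g')).1 hs⟩
    rcases (Emb.eq_or_of_range₂ hk').1 (j' w₂) with h1 | h1 | ⟨x, hx⟩
    · exact .inl h1
    · exact .inr h1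
    · refine absurd ?_ (h'.map_notMem k₂ (w := w₂) (by simp [hk₂]) (j'.trans g'))
      rw [RelEmbedding.trans_apply, ← hx]
      exact h'.mem (k'.trans g') x
  · intro H W hW hWX
    obtain ⟨k₁, w₁, hk₁⟩ := covers_iff.1 hW
    obtain ⟨j⟩ := hWX.exists_emb
    have hu : j w₁ = v ∨ j w₁ = w := by
      rcases (Emb.eq_or_of_range₂ hk).1 (j w₁) with h1 | h1 | ⟨x, hx⟩
      · exact .inl h1
      · exact .inr h1
      · refine absurd ?_ (h.map_notMem k₁ (w := w₁) (by simp [hk₁]) (j.trans g))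
        rw [RelEmbedding.trans_apply, ← hx]
        exact h.mem (k.trans g) x
    obtain ⟨u', hu', hd⟩ := H _ hu
    have hur : u' ∉ Set.range k' := by rw [hk']; exact not_not_intro hu'
    obtain ⟨W', j', k₂, w₂, hk₂, -, rfl⟩ := exists_extension k' hur
    exact ⟨W', covers_iff.2 ⟨k₂, w₂, hk₂⟩, j'.isSub,
      (h.sameNumber_iff h' hk₁ (j.trans g) hk₂ (j'.trans g')).2 hd⟩

/-- Core vertices always have loops, so only the added vertex matters. -/
theorem isReflexive_iff (h : CoreOn K A Q) {k : Emb K W} {w : W.V} (hk : Set.range k = {w}ᶜ)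
    (g : Emb W A) : IsReflexive W ↔ A.Adj (g w) (g w) := by
  rw [Adj, g.map_rel_iff]
  refine ⟨fun H => H w, fun H x => ?_⟩
  rcases (Emb.eq_or_of_range hk).1 x with rfl | ⟨y, rfl⟩
  · exact H
  · exact h.full.adj k y y

/-- Numbers are injective outside the core, so `φ` is determined there. One-vertex extensions take
care of loops and two-vertex extensions of the other edges. The type of an extension forgets the
order of its two added vertices, but the numbers restore it, which is why edges are recorded as
going up or down. -/
theorem numberLE_iff (h : CoreOn K A Q) (hN : Numbered A Q) (h' : CoreOn K A' Q')
    (hN' : Numbered A' Q') : NumberLE K A A' ↔ ∃ φ : A.V → A'.V,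
      (∀ v ∉ Q, φ v ∉ Q' ∧ outDeg A Q v = outDeg A' Q' (φ v)) ∧
      ∀ v ∉ Q, ∀ w ∉ Q, A.Adj v w → A'.Adj (φ v) (φ w) := by
  constructor
  · rintro ⟨H1, H2⟩
    obtain ⟨f⟩ := h.isSub.exists_emb
    obtain ⟨f'⟩ := h'.isSub.exists_emb
    have key : ∀ v, ∃ v', v ∉ Q → (v' ∉ Q' ∧ outDeg A Q v = outDeg A' Q' v') ∧
        (A.Adj v v → A'.Adj v' v') := by
      intro v
      by_cases hv : v ∈ Q
      · obtain ⟨v'⟩ := A'.nonempty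
        exact ⟨v', fun hv' => absurd hv hv'⟩
      · have hvf := hv
        rw [← h.range_eq f] at hvf
        obtain ⟨W, g, k, w, hk, -, rfl⟩ := exists_extension f hvf
        obtain ⟨W', hW', hg', hs, hr⟩ := H1 W (covers_iff.2 ⟨k, w, hk⟩) g.isSub
        obtain ⟨k', w', hk'⟩ := covers_iff.1 hW'
        obtain ⟨g'⟩ := hg'.exists_emb
        rw [h.isReflexive_iff hk g, h'.isReflexive_iff hk' g'] at hr
        exact ⟨g' w', fun _ => ⟨⟨h'.map_notMem k' (by simp [hk']) g',
          (h.sameNumber_iff h' hk g hk' g').1 hs⟩, hr⟩⟩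
    choose φ hφ using key
    refine ⟨φ, fun v hv => (hφ v hv).1, fun v hv w hw hvw => ?_⟩
    by_cases hne : v = w
    · subst hne
      exact (hφ v hv).2 hvw
    obtain ⟨⟨hv1, hv2⟩, -⟩ := hφ v hv
    obtain ⟨⟨hw1, hw2⟩, -⟩ := hφ w hw
    have hne' : φ v ≠ φ w := fun he => hne (hN.outDeg_injOn hv hw (by rw [hv2, hw2, he]))
    have hvf := hv
    have hwf := hw
    have hvf' := hv1
    have hwf' := hw1
    rw [← h.range_eq f] at hvf hwf
    rw [← h'.range_eq f'] at hvf' hwf'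
    obtain ⟨X, g, k, x, y, hxy, hk, -, hgx, hgy⟩ := exists_extension₂ f hvf hwf hne
    obtain ⟨X', g', k', x', y', hxy', hk', -, hgx', hgy'⟩ := exists_extension₂ f' hvf' hwf' hne'
    obtain ⟨hup, hdown⟩ := H2 X (covers₂_iff.2 ⟨k, x, y, hxy, hk⟩) g.isSub X'
      (covers₂_iff.2 ⟨k', x', y', hxy', hk'⟩) g'.isSub <| by
        rw [h.sameNumbers_iff h' hk g hk' g']
        rintro u (rfl | rfl)
        · exact ⟨x', .inl rfl, by rw [hgx, hgx', hv2]⟩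
        · exact ⟨y', .inr rfl, by rw [hgy, hgy', hw2]⟩
    rw [h.hasUpEdge_iff hN hxy hk g, h'.hasUpEdge_iff hN' hxy' hk' g', hgx, hgy, hgx', hgy',
      ← hv2, ← hw2] at hup
    rw [h.hasDownEdge_iff hN hxy hk g, h'.hasDownEdge_iff hN' hxy' hk' g', hgx, hgy, hgx', hgy',
      ← hv2, ← hw2] at hdown
    rcases lt_trichotomy (outDeg A Q v) (outDeg A Q w) with hlt | heq | hlt
    · rcases hup (.inl ⟨hvw, hlt⟩) with h1 | h1
      · exact h1.1
      · exact absurd h1.2 hlt.not_gt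
    · exact absurd (hN.outDeg_injOn hv hw heq) hne
    · rcases hdown (.inr ⟨hvw, hlt⟩) with h1 | h1
      · exact absurd h1.2 hlt.not_gt
      · exact h1.1
  · rintro ⟨φ, hφ, hadj⟩
    refine ⟨fun W hW hWA => ?_, fun X hX hXA X' hX' hXA' hs => ?_⟩
    · obtain ⟨k, w, hk⟩ := covers_iff.1 hW
      obtain ⟨g⟩ := hWA.exists_emb
      obtain ⟨f'⟩ := h'.isSub.exists_emb
      have hw := h.map_notMem k (w := w) (by simp [hk]) g
      obtain ⟨hφw, hd⟩ := hφ _ hw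
      have hφf := hφw
      rw [← h'.range_eq f'] at hφf
      obtain ⟨W', g', k', w', hk', -, hgw'⟩ := exists_extension f' hφf
      refine ⟨W', covers_iff.2 ⟨k', w', hk'⟩, g'.isSub, ?_, ?_⟩
      · rw [h.sameNumber_iff h' hk g hk' g', hgw', hd]
      · rw [h.isReflexive_iff hk g, h'.isReflexive_iff hk' g', hgw']
        exact hadj _ hw _ hw
    · obtain ⟨k, v, w, hvw, hk⟩ := covers₂_iff.1 hX
      obtain ⟨g⟩ := hXA.exists_emb
      obtain ⟨k', v', w', hvw', hk'⟩ := covers₂_iff.1 hX'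
      obtain ⟨g'⟩ := hXA'.exists_emb
      have hv := h.map_notMem k (w := v) (by simp [hk]) g
      have hw := h.map_notMem k (w := w) (by simp [hk]) g
      have hv' := h'.map_notMem k' (w := v') (by simp [hk']) g'
      have hw' := h'.map_notMem k' (w := w') (by simp [hk']) g'
      have hne := g.injective.ne hvw
      rw [h.sameNumbers_iff h' hk g hk' g'] at hs
      -- Equal numbers force `φ` to send the added pair of `X` to the added pair of `X'`, possibly
      -- swapped.
      have hmatch : ∀ u, (u = v ∨ u = w) → φ (g u) = g' v' ∨ φ (g u) = g' w' := by
        intro u hu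
        obtain ⟨u', hu', hd⟩ := hs u hu
        have hgu : g u ∉ Q := by rcases hu with rfl | rfl <;> assumption
        rw [(hφ _ hgu).2] at hd
        rcases hu' with rfl | rfl
        · exact .inl (hN'.outDeg_injOn (hφ _ hgu).1 hv' hd)
        · exact .inr (hN'.outDeg_injOn (hφ _ hgu).1 hw' hd)
      have hφne : φ (g v) ≠ φ (g w) := fun he =>
        hne (hN.outDeg_injOn hv hw (by rw [(hφ _ hv).2, (hφ _ hw).2, he]))
      have h1 := hadj _ hv _ hw
      have h2 := hadj _ hw _ hv
      rw [h.hasUpEdge_iff hN hvw hk g, h'.hasUpEdge_iff hN' hvw' hk' g',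
        h.hasDownEdge_iff hN hvw hk g, h'.hasDownEdge_iff hN' hvw' hk' g', (hφ _ hv).2,
        (hφ _ hw).2]
      rcases hmatch v (.inl rfl) with e1 | e1 <;> rcases hmatch w (.inr rfl) with e2 | e2
      · exact absurd (e1.trans e2.symm) hφne
      · rw [← e1, ← e2]
        tauto
      · rw [← e1, ← e2]
        tauto
      · exact absurd (e1.trans e2.symm) hφne

end CoreOn

end FinDigraph

/-! ### Construction of frames and the two directions of the equivalence -/

namespace FinDigraph

variable {K E Z G H : FinDigraph}

theorem FrameOn.coreOn {Q R : Set Z.V} (h : FrameOn K E Z Q R) :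
    CoreOn K (Z.ind Rᶜ h.nonempty_compl_right) {x | x.1 ∈ Q} := by
  refine ⟨h.full, h.nontrivial_left, h.isLargest_left.2.1.1, fun f => ?_, fun q hq v hv =>
    h.noEdgeIn _ hq _ hv v.2⟩
  have := h.range_left (f.trans (Z.indEmb _ _))
  ext y
  constructor
  · rintro ⟨x, rfl⟩
    exact h.mem_left (f.trans (Z.indEmb _ _)) x
  · intro hy
    obtain ⟨x, hx⟩ := this.superset hy
    exact ⟨x, Subtype.ext hx⟩

/-- The edgeless digraph with `n + 1` vertices. -/
def edgelessDigraph (n : ℕ) : FinDigraph := ⟨Fin (n + 1), ⟨fun _ _ => False⟩⟩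

/-- The edge relation of the frame of `G` with respect to the numbering `ν`. -/
def frameAdj (G : FinDigraph) {N : ℕ} (ν : G.V → Fin N) :
    G.V ⊕ (Fin (N + 2) ⊕ Fin (N + 2)) → G.V ⊕ (Fin (N + 2) ⊕ Fin (N + 2)) → Prop
  | .inl v, .inl w => G.Adj v w
  | .inl v, .inr (.inl q) => q.val < (ν v).val
  | .inl _, .inr (.inr _) => True
  | .inr _, .inl _ => False
  | .inr (.inl _), .inr _ => True
  | .inr (.inr _), .inr (.inl _) => True
  | .inr (.inr _), .inr (.inr _) => False

/-- The digraph composed of `G`, a full digraph, and an edgeless digraph, in which the vertices of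
`G` are numbered by their out-degrees to the full digraph. -/
def frame (G : FinDigraph) {N : ℕ} (ν : G.V → Fin N) : FinDigraph :=
  haveI := G.finite
  ⟨G.V ⊕ (Fin (N + 2) ⊕ Fin (N + 2)), ⟨frameAdj G ν⟩⟩

/-- The vertices of the full part of a frame. -/
def frameLeft (G : FinDigraph) {N : ℕ} (ν : G.V → Fin N) : Set (frame G ν).V :=
  Set.range fun q : Fin (N + 2) => Sum.inr (Sum.inl q)

/-- The vertices of the edgeless part of a frame. -/
def frameRight (G : FinDigraph) {N : ℕ} (ν : G.V → Fin N) : Set (frame G ν).V :=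
  Set.range fun r : Fin (N + 2) => Sum.inr (Sum.inr r)

theorem eq_inl_of_notMem {N : ℕ} {ν : G.V → Fin N} {v : (frame G ν).V} (hl : v ∉ frameLeft G ν)
    (hr : v ∉ frameRight G ν) : ∃ a : G.V, v = Sum.inl a := by
  rcases v with a | q | r
  · exact ⟨a, rfl⟩
  · exact absurd ⟨q, rfl⟩ hl
  · exact absurd ⟨r, rfl⟩ hr

/-- `G` has at most `N` vertices, so the `N + 2` vertices of a copy of `K` or `E` cannot all lie in
it. The same choice keeps both parts nontrivial for every `N`. -/
theorem not_forall_eq_inl {N : ℕ} {ν : G.V → Fin N} (hν : Function.Injective ν)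
    {f : Fin (N + 1 + 1) → (frame G ν).V} (hf : Function.Injective f) :
    ¬ ∀ x, ∃ a : G.V, f x = Sum.inl a := by
  intro h
  choose a ha using h
  have : Function.Injective fun x => ν (a x) := fun x y hxy =>
    hf (by rw [ha, ha, hν hxy])
  have := Fintype.card_le_of_injective _ this
  simp at this

theorem eq_range_of_subset {N : ℕ} {ν : G.V → Fin N} {f g : Fin (N + 1 + 1) → (frame G ν).V}
    (hf : Function.Injective f) (hg : Function.Injective g) (h : ∀ x, f x ∈ Set.range g) :
    Set.range f = Set.range g := by
  have := (frame G ν).finite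
  refine Set.eq_of_subset_of_ncard_le (Set.range_subset_iff.2 h) ?_
  rw [Set.ncard_range_of_injective hf, Set.ncard_range_of_injective hg]

theorem frameOn_frame {N : ℕ} {ν : G.V → Fin N} (hν : Function.Injective ν) :
    FrameOn (fullDigraph (N + 1)) (edgelessDigraph (N + 1)) (frame G ν) (frameLeft G ν)
      (frameRight G ν) where
  full := isFull_fullDigraph _
  nontrivial_left := ⟨(0 : Fin (N + 2)), (1 : Fin (N + 2)), Fin.zero_ne_one⟩
  edgeless := fun _ _ => id
  nontrivial_right := ⟨(0 : Fin (N + 2)), (1 : Fin (N + 2)), Fin.zero_ne_one⟩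
  isSub_left := Emb.isSub ⟨⟨fun q => Sum.inr (Sum.inl q), fun _ _ h =>
    Sum.inl_injective (Sum.inr_injective h)⟩, Iff.rfl⟩
  isSub_right := Emb.isSub ⟨⟨fun q => Sum.inr (Sum.inr q), fun _ _ h =>
    Sum.inr_injective (Sum.inr_injective h)⟩, Iff.rfl⟩
  range_left f := by
    refine eq_range_of_subset f.injective (fun _ _ h => Sum.inl_injective (Sum.inr_injective h))
      fun x => ?_
    have hadj : ∀ x y, (frame G ν).Adj (f x) (f y) := (isFull_fullDigraph _).adj f
    have hr : ∀ x, f x ∉ frameRight G ν := fun x ⟨r, hr⟩ => by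
      have := hadj x x
      rw [← hr] at this
      exact this
    by_contra hx
    -- A copy of `K` containing a vertex of `G` cannot meet the full part, which sends no edges to
    -- `G`; being looped it also avoids the edgeless part, so it would lie in `G`.
    obtain ⟨a, ha⟩ := eq_inl_of_notMem hx (hr x)
    refine not_forall_eq_inl hν f.injective fun y => eq_inl_of_notMem ?_ (hr y)
    rintro ⟨q, hq⟩
    have := hadj y x
    rw [← hq, ha] at this
    exact this
  range_right f := by
    refine eq_range_of_subset f.injective (fun _ _ h => Sum.inr_injective (Sum.inr_injective h))
      fun x => ?_
    have hadj : ∀ x y, ¬ (frame G ν).Adj (f x) (f y) :=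
      IsEdgeless.not_adj (K := edgelessDigraph (N + 1)) (fun _ _ => id) f
    have hl : ∀ x, f x ∉ frameLeft G ν := fun x ⟨r, hr⟩ => by
      have := hadj x x
      rw [← hr] at this
      exact this trivial
    by_contra hx
    -- A copy of `E` containing a vertex of `G` cannot meet the edgeless part, to which that vertex
    -- sends edges, so it would lie in `G`.
    obtain ⟨a, ha⟩ := eq_inl_of_notMem (hl x) hx
    refine not_forall_eq_inl hν f.injective fun y => eq_inl_of_notMem (hl y) ?_
    rintro ⟨q, hq⟩
    have := hadj x y
    rw [← hq, ha] at this
    exact this trivial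
  join := by
    rintro _ ⟨q, rfl⟩ _ ⟨r, rfl⟩
    exact ⟨trivial, trivial⟩
  noEdgeIn := by
    rintro _ ⟨q, rfl⟩ v hl hr
    obtain ⟨a, rfl⟩ := eq_inl_of_notMem hl hr
    exact id
  allEdgesOut := by
    rintro _ ⟨q, rfl⟩ v hl hr
    obtain ⟨a, rfl⟩ := eq_inl_of_notMem hl hr
    exact ⟨trivial, id⟩

/-- The inclusion of `G` into its frame. -/
def toFrame (G : FinDigraph) {N : ℕ} (ν : G.V → Fin N) : Emb G (frame G ν) :=
  ⟨⟨Sum.inl, Sum.inl_injective⟩, Iff.rfl⟩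

theorem range_toFrame {N : ℕ} (ν : G.V → Fin N) :
    Set.range (toFrame G ν) = (frameLeft G ν ∪ frameRight G ν)ᶜ := by
  ext v
  constructor
  · rintro ⟨a, rfl⟩ (⟨q, hq⟩ | ⟨q, hq⟩) <;> cases hq
  · intro h
    obtain ⟨a, rfl⟩ := eq_inl_of_notMem (fun h' => h (.inl h')) (fun h' => h (.inr h'))
    exact ⟨a, rfl⟩

theorem outDeg_frame {N : ℕ} {ν : G.V → Fin N} (hν : Function.Injective ν) (a : G.V)
    (ha : Sum.inl a ∈ (frameRight G ν)ᶜ) :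
    outDeg ((frame G ν).ind _ (frameOn_frame hν).nonempty_compl_right)
      {x | x.1 ∈ frameLeft G ν} ⟨Sum.inl a, ha⟩ = {q : Fin (N + 2) | q.val < (ν a).val}.ncard := by
  let g : Fin (N + 2) → ((frame G ν).ind _ (frameOn_frame hν).nonempty_compl_right).V :=
    fun q => ⟨Sum.inr (Sum.inl q), (frameOn_frame hν).disjoint _ ⟨q, rfl⟩⟩
  have hg : Function.Injective g := fun _ _ h =>
    Sum.inl_injective (Sum.inr_injective (congrArg Subtype.val h))
  rw [← Set.ncard_image_of_injective _ hg]
  unfold outDeg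
  congr 1
  ext ⟨x, hx⟩
  constructor
  · rintro ⟨⟨q, rfl⟩, h⟩
    exact ⟨q, h, rfl⟩
  · rintro ⟨q, hq, h⟩
    rw [← h]
    exact ⟨⟨q, rfl⟩, hq⟩

theorem numbered_frame {N : ℕ} {ν : G.V → Fin N} (hν : Function.Injective ν) :
    CoreOn.Numbered ((frame G ν).ind _ (frameOn_frame hν).nonempty_compl_right)
      {x | x.1 ∈ frameLeft G ν} := by
  have key : ∀ a b : G.V, (∃ q ∈ frameLeft G ν, (frame G ν).Adj (Sum.inl b) q ∧
      ¬ (frame G ν).Adj (Sum.inl a) q) ↔ ν a < ν b := by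
    intro a b
    constructor
    · rintro ⟨_, ⟨q, rfl⟩, h1, h2⟩
      exact (not_lt.1 h2).trans_lt h1
    · intro h
      exact ⟨_, ⟨⟨(ν a).val, by omega⟩, rfl⟩, h, lt_irrefl _⟩
  have key' : ∀ v w : ((frame G ν).ind _ (frameOn_frame hν).nonempty_compl_right).V,
      (∃ q ∈ {x : ((frame G ν).ind _ (frameOn_frame hν).nonempty_compl_right).V |
        x.1 ∈ frameLeft G ν}, (frame G ν).Adj w.1 q.1 ∧ ¬ (frame G ν).Adj v.1 q.1) ↔
      ∃ q ∈ frameLeft G ν, (frame G ν).Adj w.1 q ∧ ¬ (frame G ν).Adj v.1 q := by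
    intro v w
    exact ⟨fun ⟨q, hq, h⟩ => ⟨q.1, hq, h⟩,
      fun ⟨q, hq, h⟩ => ⟨⟨q, (frameOn_frame hν).disjoint q hq⟩, hq, h⟩⟩
  intro v w hv hw hvw
  suffices h : ((∃ q ∈ frameLeft G ν, (frame G ν).Adj w.1 q ∧ ¬ (frame G ν).Adj v.1 q) ∨
      ∃ q ∈ frameLeft G ν, (frame G ν).Adj v.1 q ∧ ¬ (frame G ν).Adj w.1 q) ∧
      ¬ ((∃ q ∈ frameLeft G ν, (frame G ν).Adj w.1 q ∧ ¬ (frame G ν).Adj v.1 q) ∧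
      ∃ q ∈ frameLeft G ν, (frame G ν).Adj v.1 q ∧ ¬ (frame G ν).Adj w.1 q) by
    rw [← key', ← key'] at h
    exact h
  obtain ⟨v, hv'⟩ := v
  obtain ⟨w, hw'⟩ := w
  obtain ⟨a, rfl⟩ := eq_inl_of_notMem hv hv'
  obtain ⟨b, rfl⟩ := eq_inl_of_notMem hw hw'
  have hab : ν a ≠ ν b := hν.ne fun h => hvw (Subtype.ext (congrArg Sum.inl h))
  rw [key, key]
  exact ⟨lt_or_gt_of_ne hab, fun h => lt_asymm h.1 h.2⟩

/-- `G` is numbered by `ν ∘ t`, so each vertex has the number of its image, and both frames use the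
same `K` and `E`. -/
theorem Embeds.embedsFormula (h : G.Embeds H) : EmbedsFormula G H := by
  obtain ⟨t, ht, hadj⟩ := h
  have := H.finite
  let ν : H.V → Fin (Nat.card H.V) := Finite.equivFin H.V
  have hν : Function.Injective ν := (Finite.equivFin H.V).injective
  have hμ : Function.Injective (ν ∘ t) := hν.comp ht
  have hG := frameOn_frame (G := G) hμ
  have hH := frameOn_frame (G := H) hν
  refine ⟨_, _, _, _, _, _, _, _, ⟨hG.isFrame, hG.isMeet _ (range_toFrame _),
    hG.coreOn.isNumbered_iff.2 (numbered_frame hμ)⟩, ⟨hH.isFrame, hH.isMeet _ (range_toFrame _),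
    hH.coreOn.isNumbered_iff.2 (numbered_frame hν)⟩, ?_⟩
  rw [hG.coreOn.numberLE_iff (numbered_frame hμ) hH.coreOn (numbered_frame hν)]
  have hnr : ∀ b : H.V, Sum.inl b ∈ (frameRight H ν)ᶜ := by
    rintro b ⟨q, hq⟩
    cases hq
  obtain ⟨b₀⟩ := H.nonempty
  -- The value `b₀` on the core is arbitrary; only vertices outside it are constrained.
  refine ⟨fun x => ⟨Sum.inl (Sum.elim t (fun _ => b₀) x.1), hnr _⟩, ?_, ?_⟩
  · rintro ⟨v, hv'⟩ hv
    obtain ⟨a, rfl⟩ := eq_inl_of_notMem hv hv'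
    refine ⟨?_, ?_⟩
    · rintro ⟨q, hq⟩
      cases hq
    · rw [outDeg_frame hμ a hv']
      exact (outDeg_frame hν (t a) (hnr _)).symm
  · rintro ⟨v, hv'⟩ hv ⟨w, hw'⟩ hw hvw
    obtain ⟨a, rfl⟩ := eq_inl_of_notMem hv hv'
    obtain ⟨b, rfl⟩ := eq_inl_of_notMem hw hw'
    exact hadj a b hvw

/-- The map `φ` between the outer vertices of `A` and `A'` is carried back to `G` and `H`. It is
injective because it preserves numbers and numbers distinguish the vertices of `G`. -/
theorem EmbedsFormula.embeds (h : EmbedsFormula G H) : G.Embeds H := by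
  obtain ⟨K, E, Z, A, B, Z', A', B', ⟨hF, hM, hN⟩, ⟨hF', hM', hN'⟩, hle⟩ := h
  obtain ⟨Q, e, hC, he⟩ := hF.exists_coreOn hM
  obtain ⟨Q', e', hC', he'⟩ := hF'.exists_coreOn hM'
  rw [hC.isNumbered_iff] at hN
  rw [hC'.isNumbered_iff] at hN'
  obtain ⟨φ, hφ, hadj⟩ := (hC.numberLE_iff hN hC' hN').1 hle
  have heQ : ∀ x, e x ∉ Q := fun x => he.subset ⟨x, rfl⟩
  have hlift : ∀ x, ∃ y, e' y = φ (e x) := fun x => he'.superset (hφ _ (heQ x)).1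
  choose t ht using hlift
  refine ⟨t, fun x y hxy => e.injective (hN.outDeg_injOn (heQ x) (heQ y) ?_), fun x y hxy => ?_⟩
  · rw [(hφ _ (heQ x)).2, (hφ _ (heQ y)).2, ← ht, ← ht, hxy]
  · rw [← e'.map_rel_iff, ht, ht]
    exact hadj _ (heQ x) _ (heQ y) (e.map_rel_iff.2 hxy)

end FinDigraph

/-! ### The theorem for isomorphism types -/

theorem DigraphType.definableIn_embeds :
    DefinableIn IsSub small {x : Fin 2 → DigraphType | Embeds (x 0) (x 1)} := by
  obtain ⟨s, hs, h⟩ := DefPred.embedsFormula (0 : Fin 2) 1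
  suffices hsE : {x : Fin 2 → DigraphType | Embeds (x 0) (x 1)} = s by rw [hsE]; exact hs
  ext x
  choose v hv using fun i => Quotient.exists_rep (x i)
  obtain rfl : (fun i => (Quotient.mk _ (v i) : DigraphType)) = x := funext hv
  exact (show _ ↔ _ from
    ⟨FinDigraph.Embeds.embedsFormula, FinDigraph.EmbedsFormula.embeds⟩).trans (h v)

theorem theorem1 :
    DigraphType.small.Finite ∧
    DigraphType.DefinableIn DigraphType.IsSub DigraphType.small
      {x : Fin 2 → DigraphType | DigraphType.Embeds (x 0) (x 1)} ∧
    ∀ (n : ℕ) (R : Set (Fin n → DigraphType)),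
      DigraphType.DefinableIn DigraphType.Embeds ∅ R →
      DigraphType.DefinableIn DigraphType.IsSub DigraphType.small R :=
  ⟨DigraphType.small_finite, DigraphType.definableIn_embeds, fun _ R hR =>
    DigraphType.definableIn_of_definableIn_empty DigraphType.definableIn_embeds R hR⟩
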